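/- **Setting.** Let $\varphi\in\mathcal S(\mathbb R^3)$ be radially symmetric, supported in $\{3/4\le|\xi|\le 8/3\}$, with $\sum_{j\in\mathbb Z}\varphi(2^{-j}\xi)=1$ for $\xi\ne0$, and put $\varphi_j(\xi)=\varphi(2^{-j}\xi)$. The Fourier transform is normalized so that $f(x)=\int e^{ix\cdot\xi}\hat f(\xi)\,d\xi$. For $s\in\mathbb R$ and $1\le p,q\le\infty$, $F\dot B^s_{p,q}$ is the set of the ($\mathbb C^3$-valued) tempered distributions $f$ on $\mathbb R^3$ with $\hat f\in L^1_{loc}$ and $\|f\|_{F\dot B^s_{p,q}}=\big\|\big(2^{js}\|\varphi_j\hat f\|_{L^p}\big)_{j\in\mathbb Z}\big\|_{\ell^q}<\infty$. With $I=(0,\infty)$, $\mathcal L^\infty(I;F\dot B^s_{p,q})$ is the set of the measurable $f:I\to F\dot B^s_{p,q}$ with $\|f\|_{\mathcal L^\infty(I;F\dot B^s_{p,q})}=\big\|\big(2^{js}\,\mathrm{ess\,sup}_{t\in I}\|\varphi_j\hat f(t)\|_{L^p}\big)_{j\in\mathbb Z}\big\|_{\ell^q}<\infty$. Let $\nu>0$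 and $\Omega\in\mathbb R$. The fractional Stokes–Coriolis semigroup is given by $$(S^\alpha_\Omega(t)f)^\wedge(\xi)=e^{-\nu t|\xi|^{2\alpha}}\Big(\cos\big(\Omega t\tfrac{\xi_3}{|\xi|}\big)I+\sin\big(\Omega t\tfrac{\xi_3}{|\xi|}\big)R(\xi)\Big)\hat f(\xi),\qquad R(\xi)=\frac1{|\xi|}\begin{pmatrix}0&\xi_3&-\xi_2\\-\xi_3&0&\xi_1\\ \xi_2&-\xi_1&0\end{pmatrix}.$$ Let $\mathbb P$ be the Leray projector, with symbol $\delta_{mk}-\xi_m\xi_k/|\xi|^2$, and let $B(v,w)(t)=-\int_0^tS^\alpha_\Omega(t-\tau)\mathbb P\nabla\cdot(v\otimes w)(\tau)\,d\tau$. A global mild solution of the fractional Navier–Stokes–Coriolis system $$\partial_tu+\nu(-\Delta)^\alpha u+u\cdot\nabla u+\Omega e_3\times u+\nabla \pi=F,\qquad \operatorname{div}u=0,\qquad u(0)=u_0$$ (with pressure $\pi$) is a $u$ such that, for every $t>0$, $$u(t)=S^\alpha_\Omega(t)u_0+B(u,u)(t)+\int_0^tS^\alpha_\Omega(t-\tau)\mathbb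 PF(\tau)\,d\tau,$$ where the integrals are taken in Fourier variables, for almost every $\xi$. **Theorem.** Let $1<p\le\infty$, $1\le q\le\infty$, $\nu>0$ and $\frac12<\alpha<\frac14\big(5-\frac3p\big)$, and write $\mathcal X=\mathcal L^\infty(I;F\dot B^{4-2\alpha-3/p}_{p,q})$. There is a constant $K>0$, independent of $\Omega$, with $\|B(v,w)\|_{\mathcal X}\le K\|v\|_{\mathcal X}\|w\|_{\mathcal X}$ for all $v,w\in\mathcal X$ and all $\Omega\in\mathbb R$, such that the following holds for every $0<\varepsilon<\frac1{4K}$ and every $\Omega\in\mathbb R$. Let $u_0,v_0\in F\dot B^{4-2\alpha-3/p}_{p,q}$ and $F,G\in\mathcal L^\infty(I;F\dot B^{4-4\alpha-3/p}_{p,q})$ satisfy $$\|u_0\|_{F\dot B^{4-2\alpha-3/p}_{p,q}}+\|F\|_{\mathcal L^\infty(I;F\dot B^{4-4\alpha-3/p}_{p,q})}<\varepsilon,\qquad \|v_0\|_{F\dot B^{4-2\alpha-3/p}_{p,q}}+\|G\|_{\mathcal L^\infty(I;F\dot B^{4-4\alpha-3/p}_{p,q})}<\varepsilon,$$ and let $u,v\in\mathcal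 X$, with $\|u\|_{\mathcal X}\le2\varepsilon$ and $\|v\|_{\mathcal X}\le2\varepsilon$, be global mild solutions with the data $(u_0,F)$ and $(v_0,G)$ respectively. If $$\lim_{t\to\infty}\|S^\alpha_\Omega(t)(u_0-v_0)\|_{F\dot B^{4-2\alpha-3/p}_{p,q}}=0\quad\text{and}\quad\lim_{t\to\infty}\|F(t)-G(t)\|_{F\dot B^{4-4\alpha-3/p}_{p,q}}=0,$$ then $$\lim_{t\to\infty}\|u(t)-v(t)\|_{F\dot B^{4-2\alpha-3/p}_{p,q}}=0.$$ -/

import Mathlib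

open MeasureTheory Filter Set
open scoped ENNReal Topology SchwartzMap FourierTransform Matrix

noncomputable section

namespace FNSC

/-- Physical space and frequency space. -/
abbrev R3 := EuclideanSpace ℝ (Fin 3)

/-- Values of the vector fields. -/
abbrev C3 := EuclideanSpace ℂ (Fin 3)

/-! ### Littlewood-Paley decomposition and Fourier-Besov spaces -/

/-- `φ` is radially symmetric, supported in `3/4 ≤ |ξ| ≤ 8/3`, and `∑_{j ∈ ℤ} φ(2^{-j} ξ) = 1`
for `ξ ≠ 0`. -/
structure IsLittlewoodPaley (φ : 𝓢(R3, ℝ)) : Prop where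
  radial : ∀ ξ η : R3, ‖ξ‖ = ‖η‖ → φ ξ = φ η
  supp : ∀ ξ : R3, φ ξ ≠ 0 → 3 / 4 ≤ ‖ξ‖ ∧ ‖ξ‖ ≤ 8 / 3
  partition : ∀ ξ : R3, ξ ≠ 0 → HasSum (fun j : ℤ => φ ((2 : ℝ) ^ (-j) • ξ)) 1

/-- The Fourier transform of the tempered distribution `f` is the locally integrable function `g`.
The normalization is `f(x) = ∫ e^{i x·ξ} g(ξ) dξ`, i.e. `g(ξ) = (2π)^{-3} ∫ e^{-i x·ξ} f(x) dx`,
for which differentiation is multiplication by `iξ` and the transform of a product is exactly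
the convolution of the transforms. Mathlib's transform is
`(𝓕 f)(η) = ∫ e^{-2π i x·η} f(x) dx = (2π)^3 g(2π η)`. -/
def HasFourier (f : 𝓢'(R3, C3)) (g : R3 → C3) : Prop :=
  LocallyIntegrable g volume ∧
    ∀ θ : 𝓢(R3, ℂ), HasCompactSupport θ →
      (𝓕 f) θ = ∫ η : R3, θ η • ((2 * Real.pi) ^ 3 • g ((2 * Real.pi) • η))

open Classical in
/-- The function `f̂`, when `f̂` is locally integrable (it is then unique almost everywhere). -/
def fourierFun (f : 𝓢'(R3, C3)) : R3 → C3 :=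
  if h : ∃ g, HasFourier f g then h.choose else 0

/-- `‖φ_j g‖_{L^p}` with `φ_j(ξ) = φ(2^{-j} ξ)`. -/
def block (φ : 𝓢(R3, ℝ)) (p : ℝ≥0∞) (j : ℤ) (g : R3 → C3) : ℝ≥0∞ :=
  eLpNorm (fun ξ => φ ((2 : ℝ) ^ (-j) • ξ) • g ξ) p volume

/-- `( ∑_j 2^{jsq} a_j^q )^{1/q}`, and `sup_j 2^{js} a_j` for `q = ∞`. -/
def seqNorm (s : ℝ) (q : ℝ≥0∞) (a : ℤ → ℝ≥0∞) : ℝ≥0∞ :=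
  eLpNorm (fun j : ℤ => ENNReal.ofReal ((2 : ℝ) ^ ((j : ℝ) * s)) * a j) q Measure.count

/-- The `FḂ^s_{p,q}` norm of the distribution whose Fourier transform is `g`. -/
def fbNormHat (φ : 𝓢(R3, ℝ)) (s : ℝ) (p q : ℝ≥0∞) (g : R3 → C3) : ℝ≥0∞ :=
  seqNorm s q fun j => block φ p j g

/-- The `FḂ^s_{p,q}` norm. -/
def fbNorm (φ : 𝓢(R3, ℝ)) (s : ℝ) (p q : ℝ≥0∞) (f : 𝓢'(R3, C3)) : ℝ≥0∞ :=
  fbNormHat φ s p q (fourierFun f)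

/-- `f ∈ FḂ^s_{p,q}`. -/
def MemFB (φ : 𝓢(R3, ℝ)) (s : ℝ) (p q : ℝ≥0∞) (f : 𝓢'(R3, C3)) : Prop :=
  (∃ g, HasFourier f g) ∧ fbNorm φ s p q f < ∞

/-! ### Time-dependent spaces on `I = (0, ∞)` -/

/-- `U(t, ξ)` is a jointly measurable version of the Fourier transform of `f(t)`, `t > 0`. -/
def HasFourierPath (f : ℝ → 𝓢'(R3, C3)) (U : ℝ → R3 → C3) : Prop :=
  AEStronglyMeasurable (Function.uncurry U)
      (((volume : Measure ℝ).restrict (Ioi 0)).prod (volume : Measure R3)) ∧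
    ∀ t > 0, HasFourier (f t) (U t)

/-- The norm of `𝓛^∞(I; FḂ^s_{p,q})`, of a path given by its Fourier transform:
`‖ 2^{js} ess sup_{t > 0} ‖φ_j U(t)‖_{L^p} ‖_{ℓ^q}`. -/
def pathNormHat (φ : 𝓢(R3, ℝ)) (s : ℝ) (p q : ℝ≥0∞) (U : ℝ → R3 → C3) : ℝ≥0∞ :=
  seqNorm s q fun j =>
    essSup (fun t => block φ p j (U t)) ((volume : Measure ℝ).restrict (Ioi 0))

/-- The norm of `𝓛^∞(I; FḂ^s_{p,q})`. -/
def pathNorm (φ : 𝓢(R3, ℝ)) (s : ℝ) (p q : ℝ≥0∞) (f : ℝ → 𝓢'(R3, C3)) : ℝ≥0∞ :=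
  pathNormHat φ s p q fun t => fourierFun (f t)

/-- `f ∈ 𝓛^∞(I; FḂ^s_{p,q})`. The values of `f` at `t ≤ 0` play no role. The measurability that is
asked for is the joint one of `f̂(t, ξ)`, which every Bochner measurable `f` has. -/
def MemPath (φ : 𝓢(R3, ℝ)) (s : ℝ) (p q : ℝ≥0∞) (f : ℝ → 𝓢'(R3, C3)) : Prop :=
  (∃ U, HasFourierPath f U) ∧ (∀ t > 0, MemFB φ s p q (f t)) ∧ pathNorm φ s p q f < ∞

/-! ### The Stokes-Coriolis semigroup and mild solutions, in Fourier variables -/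

/-- A real matrix acting on complex vectors. -/
def act (M : Matrix (Fin 3) (Fin 3) ℝ) (z : C3) : C3 :=
  WithLp.toLp 2 ((M.map fun x : ℝ => (x : ℂ)) *ᵥ z.ofLp)

/-- The matrix `R(ξ)`. -/
def coriolisMatrix (ξ : R3) : Matrix (Fin 3) (Fin 3) ℝ :=
  !![0, ξ 2 / ‖ξ‖, -(ξ 1 / ‖ξ‖);
     -(ξ 2 / ‖ξ‖), 0, ξ 0 / ‖ξ‖;
     ξ 1 / ‖ξ‖, -(ξ 0 / ‖ξ‖), 0]

/-- The symbol of `S^α_Ω(t)`: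
`e^{-ν t |ξ|^{2α}} (cos(Ω t ξ₃/|ξ|) I + sin(Ω t ξ₃/|ξ|) R(ξ))`. -/
def semigroupSymbol (ν α Ω t : ℝ) (ξ : R3) : Matrix (Fin 3) (Fin 3) ℝ :=
  Real.exp (-ν * t * ‖ξ‖ ^ (2 * α)) •
    (Real.cos (Ω * (ξ 2 / ‖ξ‖) * t) • (1 : Matrix (Fin 3) (Fin 3) ℝ) +
      Real.sin (Ω * (ξ 2 / ‖ξ‖) * t) • coriolisMatrix ξ)

/-- The Fourier transform of `S^α_Ω(t) f`. -/
def semigroupHat (ν α Ω t : ℝ) (f : 𝓢'(R3, C3)) (ξ : R3) : C3 :=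
  act (semigroupSymbol ν α Ω t ξ) (fourierFun f ξ)

/-- The symbol of the Leray projector: `δ_{mk} - ξ_m ξ_k / |ξ|²`. -/
def leraySymbol (ξ : R3) : Matrix (Fin 3) (Fin 3) ℝ :=
  Matrix.of fun m k => (if m = k then 1 else 0) - ξ m * ξ k / ‖ξ‖ ^ 2

/-- `([v ⊗ w]^)_{mk}(ξ) = (v̂_m ∗ ŵ_k)(ξ)`, with `V = v̂`, `W = ŵ`. -/
def tensorHat (V W : R3 → C3) (ξ : R3) (m k : Fin 3) : ℂ :=
  ∫ η : R3, V (ξ - η) m * W η k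

/-- `i ξ · [v ⊗ w]^(ξ)`, the transform of `∇ · (v ⊗ w)`. -/
def divTensorHat (V W : R3 → C3) (ξ : R3) : C3 :=
  WithLp.toLp 2 fun k => ∑ m : Fin 3, Complex.I * (ξ m : ℂ) * tensorHat V W ξ m k

/-- The transform of `B(v, w)(t) = -∫_0^t S^α_Ω(t-τ) ℙ ∇·(v ⊗ w)(τ) dτ`. -/
def bilinHat (ν α Ω : ℝ) (V W : ℝ → R3 → C3) (t : ℝ) (ξ : R3) : C3 :=
  -∫ τ in (0 : ℝ)..t, act (semigroupSymbol ν α Ω (t - τ) ξ)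
      (act (leraySymbol ξ) (divTensorHat (V τ) (W τ) ξ))

/-- The transform of `∫_0^t S^α_Ω(t-τ) ℙ F(τ) dτ`, with `H = F̂`. -/
def forceHat (ν α Ω : ℝ) (H : ℝ → R3 → C3) (t : ℝ) (ξ : R3) : C3 :=
  ∫ τ in (0 : ℝ)..t, act (semigroupSymbol ν α Ω (t - τ) ξ) (act (leraySymbol ξ) (H τ ξ))

/-- `u` is a global mild solution with initial value `u₀` and external force `F`: for every `t > 0`,
`u(t) = S^α_Ω(t) u₀ + B(u, u)(t) + ∫_0^t S^α_Ω(t-τ) ℙ F(τ) dτ`, the integrals being taken in Fourier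
variables, for almost every `ξ`. -/
def IsMildSolution (ν α Ω : ℝ) (u₀ : 𝓢'(R3, C3)) (F u : ℝ → 𝓢'(R3, C3)) : Prop :=
  ∃ U H : ℝ → R3 → C3, HasFourierPath u U ∧ HasFourierPath F H ∧
    ∀ t > 0, ∀ᵐ ξ : R3,
      U t ξ = semigroupHat ν α Ω t u₀ ξ + bilinHat ν α Ω U U t ξ + forceHat ν α Ω H t ξ

/-- `‖B(v, w)‖ ≤ K ‖v‖ ‖w‖` on `𝓛^∞(I; FḂ^s_{p,q})`, for every Coriolis parameter. -/
def BilinearBound (φ : 𝓢(R3, ℝ)) (s : ℝ) (p q : ℝ≥0∞) (ν α K : ℝ) : Prop :=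
  ∀ (Ω : ℝ) (v w : ℝ → 𝓢'(R3, C3)) (V W : ℝ → R3 → C3),
    MemPath φ s p q v → MemPath φ s p q w → HasFourierPath v V → HasFourierPath w W →
      pathNormHat φ s p q (bilinHat ν α Ω V W) ≤
        ENNReal.ofReal K * pathNorm φ s p q v * pathNorm φ s p q w

end FNSC

end

open FNSC

noncomputable section

namespace FNSC

/-! The norms see only $|\hat u|$, and the entries of the Stokes–Coriolis symbol are at most
$2e^{-\nu t|\xi|^{2\alpha}}$ for every $\Omega$. So all estimates concern nonnegative functions of
$(t,\xi)$: convolutions stand for products, and `duhamel`, with the fractional heat kernel alone,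
stands for the time integrals. This makes the constants independent of $\Omega$.

The bilinear estimate `exists_bilinear_majorant` has two ingredients. The product law
`exists_conv_majorant` comes from splitting both factors dyadically: the lower frequency goes into
$L^1$ by Bernstein, the higher one stays in $L^p$. The low frequencies are summable because
$\alpha>1/2$, the high ones because $\alpha<\frac14(5-3/p)$. The Duhamel estimate `blk_duhamel_le`
recovers $2\alpha$ derivatives and also forgets the past: at time $t$ the sources before $T$ carry a
weight $T/(t-T)$. Bounds are stated through block majorants, sequences in $j$ that do not depend on
$t$, since the supremum in time is taken before the $\ell^q$ norm.

For two mild solutions write $u\otimes u-v\otimes v=u\otimes(u-v)+(u-v)\otimes v$. Let $D(T)$ be the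
norm of $u-v$ on $(T,\infty)$, and $E$, $Y$ those of the linear evolution and of the force
difference; $E$ and $Y$ vanish at infinity by `tendsto_tailNorm_zero`. Smallness gives $D(t)\le
E(t)+kD(T)+\frac{T}{t-T}M+cY(T)$ with $k\le 4K\varepsilon<1$. Letting $t\to\infty$ and then
$T\to\infty$, the limit $L$ of $D$ satisfies $L\le kL$, so $L=0$
(`tendsto_zero_of_tail_contraction`). The same inequality at a fixed time gives convergence at every
$t$, not only in the essential supremum. -/

/-! ### $L^p$ norms of extended nonnegative functions; the inequalities of Minkowski and Young. -/

theorem eLpNorm_ennreal_eq {α : Type*} [MeasurableSpace α] {μ : Measure α} {p : ℝ≥0∞}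
    (hp0 : p ≠ 0) (hp : p ≠ ∞) (f : α → ℝ≥0∞) :
    eLpNorm f p μ = (∫⁻ x, f x ^ p.toReal ∂μ) ^ (1 / p.toReal) := by
  simp [eLpNorm_eq_lintegral_rpow_enorm_toReal hp0 hp]

theorem eLpNorm_ennreal_top {α : Type*} [MeasurableSpace α] {μ : Measure α} (f : α → ℝ≥0∞) :
    eLpNorm f ∞ μ = essSup f μ := by
  simp [eLpNorm_exponent_top, eLpNormEssSup]

theorem eLpNorm_ennreal_one {α : Type*} [MeasurableSpace α] {μ : Measure α} (f : α → ℝ≥0∞) :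
    eLpNorm f 1 μ = ∫⁻ x, f x ∂μ := by
  simp [eLpNorm_one_eq_lintegral_enorm]

theorem eLpNorm_ennreal_mono_ae {α : Type*} [MeasurableSpace α] {μ : Measure α} {p : ℝ≥0∞}
    {f g : α → ℝ≥0∞} (h : ∀ᵐ x ∂μ, f x ≤ g x) : eLpNorm f p μ ≤ eLpNorm g p μ :=
  eLpNorm_mono_enorm_ae (by simpa using h)

theorem eLpNorm_ennreal_mono {α : Type*} [MeasurableSpace α] {μ : Measure α} {p : ℝ≥0∞}
    {f g : α → ℝ≥0∞} (h : ∀ x, f x ≤ g x) : eLpNorm f p μ ≤ eLpNorm g p μ :=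
  eLpNorm_mono_enorm (by simpa using h)

theorem eLpNorm_ennreal_add_le {α : Type*} [MeasurableSpace α] {μ : Measure α} {p : ℝ≥0∞}
    {f g : α → ℝ≥0∞} (hf : AEMeasurable f μ) (hg : AEMeasurable g μ) (hp : 1 ≤ p) :
    eLpNorm (fun x => f x + g x) p μ ≤ eLpNorm f p μ + eLpNorm g p μ :=
  eLpNorm_add_le hf.aestronglyMeasurable hg.aestronglyMeasurable hp

theorem eLpNorm_ennreal_const_mul {α : Type*} [MeasurableSpace α] {μ : Measure α} {p : ℝ≥0∞}
    (hp : 1 ≤ p) {f : α → ℝ≥0∞} (hf : AEMeasurable f μ) (c : ℝ≥0∞) :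
    eLpNorm (fun x => c * f x) p μ = c * eLpNorm f p μ := by
  have hp0 : p ≠ 0 := (zero_lt_one.trans_le hp).ne'
  rcases eq_or_ne p ∞ with rfl | hpt
  · rw [eLpNorm_ennreal_top, eLpNorm_ennreal_top]; exact ENNReal.essSup_const_mul
  · have hr : 0 < p.toReal := ENNReal.toReal_pos hp0 hpt
    rw [eLpNorm_ennreal_eq hp0 hpt, eLpNorm_ennreal_eq hp0 hpt]
    simp_rw [ENNReal.mul_rpow_of_nonneg _ _ hr.le]
    rw [lintegral_const_mul'' _ (hf.pow_const _), ENNReal.mul_rpow_of_nonneg _ _ (by positivity),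
      ← ENNReal.rpow_mul, mul_one_div_cancel hr.ne', ENNReal.rpow_one]

/-- **Minkowski's integral inequality**. -/
theorem eLpNorm_lintegral_le {α β : Type*} [MeasurableSpace α] [MeasurableSpace β]
    {μ : Measure α} {ν : Measure β} [SFinite μ] [SFinite ν] {p : ℝ≥0∞} (hp : 1 ≤ p)
    {g : α → β → ℝ≥0∞} (hg : AEMeasurable (Function.uncurry g) (μ.prod ν))
    {n : α → ℝ≥0∞} (hn : AEMeasurable n μ) (h : ∀ᵐ y ∂μ, eLpNorm (g y) p ν ≤ n y) :
    eLpNorm (fun x => ∫⁻ y, g y x ∂μ) p ν ≤ ∫⁻ y, n y ∂μ := by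
  have hp0 : p ≠ 0 := (zero_lt_one.trans_le hp).ne'
  rcases eq_or_ne p ∞ with rfl | hpt
  · rw [eLpNorm_ennreal_top]
    have h1 : ∀ᵐ y ∂μ, ∀ᵐ x ∂ν, g y x ≤ n y := by
      filter_upwards [h] with y hy
      rw [eLpNorm_ennreal_top] at hy
      filter_upwards [ENNReal.ae_le_essSup (g y)] with x hx using hx.trans hy
    have h2 : ∀ᵐ z ∂(μ.prod ν), Function.uncurry g z ≤ n z.1 := by
      obtain ⟨g', hg'm, hg'⟩ := hg
      obtain ⟨n', hn'm, hn'⟩ := hn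
      have hn2 : ∀ᵐ z ∂(μ.prod ν), n z.1 = n' z.1 :=
        Measure.quasiMeasurePreserving_fst.ae hn'
      have : ∀ᵐ z ∂(μ.prod ν), g' z ≤ n' z.1 := by
        refine (Measure.ae_prod_iff_ae_ae (measurableSet_le hg'm
          (hn'm.comp measurable_fst))).2 ?_
        filter_upwards [h1, Measure.ae_ae_of_ae_prod hg', hn'] with y hy1 hy2 hy3
        filter_upwards [hy1, hy2] with x hx1 hx2
        rw [← hx2]; exact hx1.trans_eq hy3
      filter_upwards [this, hg', hn2] with z a b c
      rw [b, c]; exact a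
    refine essSup_le_of_ae_le _ ?_
    have h3 : ∀ᵐ x ∂ν, ∀ᵐ y ∂μ, g y x ≤ n y :=
      Measure.ae_ae_of_ae_prod (Measure.measurePreserving_swap.quasiMeasurePreserving.ae h2)
    filter_upwards [h3] with x hx using lintegral_mono_ae hx
  rcases eq_or_lt_of_le hp with rfl | hp1
  · rw [eLpNorm_ennreal_one, lintegral_lintegral_swap]
    · refine lintegral_mono_ae ?_
      filter_upwards [h] with y hy
      rwa [eLpNorm_ennreal_one] at hy
    · exact hg.prod_swap
  set r := p.toReal with hr
  have hr1 : 1 < r := by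
    rw [hr, ← ENNReal.toReal_one]; exact ENNReal.toReal_strict_mono hpt hp1
  have hr0 : 0 < r := by linarith
  set N := ∫⁻ y, n y ∂μ with hN
  rcases eq_or_ne N ∞ with hNt | hNt
  · rw [hNt]; exact le_top
  rw [eLpNorm_ennreal_eq hp0 hpt, one_div, ENNReal.rpow_inv_le_iff hr0, ← hr]
  have hnfin : ∀ᵐ y ∂μ, n y < ∞ := ae_lt_top' hn hNt
  have h' : ∀ᵐ y ∂μ, ∫⁻ x, g y x ^ r ∂ν ≤ n y ^ r := by
    filter_upwards [h] with y hy
    rwa [eLpNorm_ennreal_eq hp0 hpt, one_div, ENNReal.rpow_inv_le_iff hr0] at hy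
  -- The weight $n^{1-r}$ used below is infinite where $n=0$; there the hypothesis forces $g=0$
  -- almost everywhere, so such points contribute nothing.
  have hzero : ∀ᵐ z ∂(μ.prod ν), n z.1 = 0 → Function.uncurry g z = 0 := by
    obtain ⟨g', hg'm, hg'⟩ := hg
    obtain ⟨n', hn'm, hn'⟩ := hn
    have hn2 : ∀ᵐ z ∂(μ.prod ν), n z.1 = n' z.1 :=
      Measure.quasiMeasurePreserving_fst.ae hn'
    have : ∀ᵐ z ∂(μ.prod ν), n' z.1 = 0 → g' z = 0 := by
      refine (Measure.ae_prod_iff_ae_ae ?_).2 ?_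
      · have : {z : α × β | n' z.1 = 0 → g' z = 0} = {z | n' z.1 = 0}ᶜ ∪ {z | g' z = 0} := by
          ext z; simp [imp_iff_not_or]
        rw [this]
        exact ((hn'm.comp measurable_fst) (measurableSet_singleton 0)).compl.union
          (hg'm (measurableSet_singleton 0))
      filter_upwards [h', Measure.ae_ae_of_ae_prod hg', hn'] with y hy1 hy2 hy3
      by_cases hz : n y = 0
      · rw [hz, ENNReal.zero_rpow_of_pos hr0, nonpos_iff_eq_zero] at hy1
        have hm : AEMeasurable (fun x => g y x ^ r) ν := by
          refine AEMeasurable.pow_const ?_ _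
          exact ⟨fun x => g' (y, x), hg'm.comp (measurable_const.prodMk measurable_id), hy2⟩
        rw [lintegral_eq_zero_iff' hm] at hy1
        filter_upwards [hy1, hy2] with x hx1 hx2 _
        rw [← hx2]
        simpa [hr0, hr0.le, not_lt.2 hr0.le] using hx1
      · rw [← hy3]; exact Eventually.of_forall fun x hx => absurd hx hz
    filter_upwards [this, hg', hn2] with z a b c
    rw [b, c]; exact a
  have hzero' : ∀ᵐ x ∂ν, ∀ᵐ y ∂μ, n y = 0 → g y x = 0 :=
    Measure.ae_ae_of_ae_prod (Measure.measurePreserving_swap.quasiMeasurePreserving.ae hzero)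
  have hgx : ∀ᵐ x ∂ν, AEMeasurable (fun y => g y x) μ := by
    have := hg.prod_swap
    obtain ⟨G, hG, hGe⟩ := this
    filter_upwards [Measure.ae_ae_of_ae_prod hGe] with x hx
    exact ⟨fun y => G (x, y), hG.comp (measurable_const.prodMk measurable_id), hx⟩
  have hc : r.HolderConjugate (Real.conjExponent r) := Real.HolderConjugate.conjExponent hr1
  set r' := Real.conjExponent r with hr'
  have hr'0 : 0 < r' := hc.symm.pos
  have hrr : r * r'⁻¹ = r - 1 := by
    have := hc.inv_add_inv_eq_one
    field_simp at this ⊢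
    linarith
  -- Hölder applied to $g=(g\,n^{-1/r'})\,n^{1/r'}$. When the result is integrated in $x$, the bound
  -- $\int g^r\,dx\le n^r$ turns $g^r n^{1-r}$ into $n$.
  have key : ∀ᵐ x ∂ν, (∫⁻ y, g y x ∂μ) ^ r ≤ N ^ (r - 1) * ∫⁻ y, g y x ^ r * n y ^ (1 - r) ∂μ := by
    filter_upwards [hzero', hgx] with x hx hxm
    have e1 : ∫⁻ y, g y x ∂μ
        = ∫⁻ y, ((fun y => g y x * n y ^ (-r'⁻¹)) * (fun y => n y ^ r'⁻¹)) y ∂μ := by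
      refine lintegral_congr_ae ?_
      filter_upwards [hx, hnfin] with y h1 h2
      by_cases hz : n y = 0
      · simp [h1 hz]
      · simp only [Pi.mul_apply]
        rw [mul_assoc, ← ENNReal.rpow_add _ _ hz h2.ne]; simp
    have e2 := ENNReal.lintegral_mul_le_Lp_mul_Lq μ hc
      (f := fun y => g y x * n y ^ (-r'⁻¹)) (g := fun y => n y ^ r'⁻¹)
      (hxm.mul (hn.pow_const _)) (hn.pow_const _)
    rw [← e1] at e2
    have e3 : ∫⁻ y, (n y ^ r'⁻¹) ^ r' ∂μ = N := by
      simp_rw [← ENNReal.rpow_mul, inv_mul_cancel₀ hr'0.ne', ENNReal.rpow_one, hN]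
    have e4 : ∀ y, (g y x * n y ^ (-r'⁻¹)) ^ r = g y x ^ r * n y ^ (1 - r) := by
      intro y
      rw [ENNReal.mul_rpow_of_nonneg _ _ hr0.le, ← ENNReal.rpow_mul]
      congr 2
      linarith
    simp_rw [e4] at e2
    rw [e3] at e2
    calc (∫⁻ y, g y x ∂μ) ^ r ≤ _ := ENNReal.rpow_le_rpow e2 hr0.le
      _ = _ := by
        rw [ENNReal.mul_rpow_of_nonneg _ _ hr0.le, ← ENNReal.rpow_mul, ← ENNReal.rpow_mul,
          one_div_mul_cancel hr0.ne', ENNReal.rpow_one, mul_comm]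
        congr 2
        rw [one_div, mul_comm, hrr]
  have hmeas : AEMeasurable (Function.uncurry fun x y => g y x ^ r * n y ^ (1 - r))
      (ν.prod μ) :=
    (hg.prod_swap.pow_const _).mul
      ((hn.pow_const _).comp_quasiMeasurePreserving Measure.quasiMeasurePreserving_snd)
  calc ∫⁻ x, (∫⁻ y, g y x ∂μ) ^ r ∂ν
      ≤ ∫⁻ x, N ^ (r - 1) * ∫⁻ y, g y x ^ r * n y ^ (1 - r) ∂μ ∂ν := lintegral_mono_ae key
    _ = N ^ (r - 1) * ∫⁻ x, ∫⁻ y, g y x ^ r * n y ^ (1 - r) ∂μ ∂ν :=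
        lintegral_const_mul' _ _ (ENNReal.rpow_ne_top_of_nonneg (by linarith) hNt)
    _ = N ^ (r - 1) * ∫⁻ y, ∫⁻ x, g y x ^ r * n y ^ (1 - r) ∂ν ∂μ := by
        rw [lintegral_lintegral_swap hmeas]
    _ ≤ N ^ (r - 1) * N := by
        gcongr
        refine lintegral_mono_ae ?_
        have hgy : ∀ᵐ y ∂μ, AEMeasurable (g y) ν := by
          obtain ⟨G, hG, hGe⟩ := hg
          filter_upwards [Measure.ae_ae_of_ae_prod hGe] with y hy
          exact ⟨fun x => G (y, x), hG.comp (measurable_const.prodMk measurable_id), hy⟩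
        filter_upwards [h', hnfin, hgy] with y h1 h2 h3
        rw [lintegral_mul_const'' _ (h3.pow_const _)]
        by_cases hz : n y = 0
        · rw [hz, ENNReal.zero_rpow_of_pos hr0, nonpos_iff_eq_zero] at h1
          simp [h1]
        · calc _ ≤ n y ^ r * n y ^ (1 - r) := by gcongr
            _ = n y := by rw [← ENNReal.rpow_add _ _ hz h2.ne]; simp
    _ = N ^ r := by
        rcases eq_or_ne N 0 with h0 | h0
        · simp [h0, hr0]
        · nth_rewrite 2 [← ENNReal.rpow_one N]
          rw [← ENNReal.rpow_add _ _ h0 hNt]; simp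

/-- Minkowski's inequality for the counting measure. -/
theorem eLpNorm_tsum_le {ι β : Type*} [Countable ι] [MeasurableSpace β] {ν : Measure β}
    [SFinite ν] {p : ℝ≥0∞} (hp : 1 ≤ p) {g : ι → β → ℝ≥0∞} (hg : ∀ i, Measurable (g i)) :
    eLpNorm (fun x => ∑' i, g i x) p ν ≤ ∑' i, eLpNorm (g i) p ν := by
  let _ : MeasurableSpace ι := ⊤
  have : MeasurableSingletonClass ι := ⟨fun _ => trivial⟩
  have h := eLpNorm_lintegral_le (μ := (Measure.count : Measure ι)) (ν := ν) hp (g := g)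
    (n := fun i => eLpNorm (g i) p ν)
    (measurable_from_prod_countable_right hg).aemeasurable
    (measurable_from_top).aemeasurable (Eventually.of_forall fun _ => le_rfl)
  simpa only [lintegral_count] using h

/-- The convolution of nonnegative functions. -/
def conv (f g : R3 → ℝ≥0∞) (x : R3) : ℝ≥0∞ :=
  ∫⁻ y, f (x - y) * g y

theorem conv_comm (f g : R3 → ℝ≥0∞) : conv f g = conv g f := by
  funext x
  unfold conv
  rw [← lintegral_sub_left_eq_self (fun y => f (x - y) * g y) x]
  simp [mul_comm]

/-- Young's inequality $L^p*L^1\subset L^p$: Minkowski's inequality for the translates of $f$, which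
all have the same norm. -/
theorem eLpNorm_conv_le {p : ℝ≥0∞} (hp : 1 ≤ p) {f g : R3 → ℝ≥0∞} (hf : Measurable f)
    (hg : Measurable g) :
    eLpNorm (conv f g) p volume ≤ eLpNorm f p volume * ∫⁻ x, g x := by
  have hm : Measurable (Function.uncurry fun y x => f (x - y) * g y) :=
    (hf.comp (measurable_snd.sub measurable_fst)).mul (hg.comp measurable_fst)
  have := eLpNorm_lintegral_le (μ := (volume : Measure R3)) (ν := (volume : Measure R3)) hp
    (g := fun y x => f (x - y) * g y) (n := fun y => eLpNorm f p volume * g y) hm.aemeasurable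
    (hg.const_mul _).aemeasurable (Eventually.of_forall fun y => by
      have hmp : MeasurePreserving (fun x : R3 => x - y) volume volume := by
        have : (volume : Measure R3).IsAddRightInvariant := inferInstance
        exact measurePreserving_sub_right volume y
      have e : eLpNorm (fun x => f (x - y)) p volume = eLpNorm f p volume :=
        eLpNorm_comp_measurePreserving (g := f) hf.aestronglyMeasurable hmp
      have := eLpNorm_ennreal_const_mul (μ := (volume : Measure R3)) hp
        (f := fun x => f (x - y)) (hf.comp (measurable_id.sub_const y)).aemeasurable (g y)
      simp only [mul_comm _ (g y)]
      rw [this, e])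
  rwa [lintegral_const_mul _ hg] at this

/-! ### Dyadic weights and weighted sequence norms. -/

/-- `2 ^ x` as an extended nonnegative real. -/
def pow2 (x : ℝ) : ℝ≥0∞ := ENNReal.ofReal ((2 : ℝ) ^ x)

theorem pow2_add (x y : ℝ) : pow2 (x + y) = pow2 x * pow2 y := by
  rw [pow2, Real.rpow_add two_pos, ENNReal.ofReal_mul (by positivity)]; rfl

theorem pow2_zero : pow2 0 = 1 := by simp [pow2]

theorem pow2_ne_top (x : ℝ) : pow2 x ≠ ∞ := ENNReal.ofReal_ne_top

theorem pow2_ne_zero (x : ℝ) : pow2 x ≠ 0 := by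
  rw [pow2, Ne, ENNReal.ofReal_eq_zero, not_le]; positivity

theorem pow2_mul_pow2_neg (x : ℝ) : pow2 x * pow2 (-x) = 1 := by
  rw [← pow2_add, add_neg_cancel, pow2_zero]

theorem pow2_neg_mul_pow2 (x : ℝ) : pow2 (-x) * pow2 x = 1 := by
  rw [← pow2_add, neg_add_cancel, pow2_zero]

theorem seqNorm_eq (s : ℝ) (q : ℝ≥0∞) (a : ℤ → ℝ≥0∞) :
    seqNorm s q a = eLpNorm (fun j : ℤ => pow2 (j * s) * a j) q Measure.count := rfl

theorem seqNorm_mono {s : ℝ} {q : ℝ≥0∞} {a b : ℤ → ℝ≥0∞} (h : ∀ j, a j ≤ b j) :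
    seqNorm s q a ≤ seqNorm s q b :=
  eLpNorm_ennreal_mono fun j => by gcongr; exact h j

theorem seqNorm_add_le {s : ℝ} {q : ℝ≥0∞} (hq : 1 ≤ q) (a b : ℤ → ℝ≥0∞) :
    seqNorm s q (fun j => a j + b j) ≤ seqNorm s q a + seqNorm s q b := by
  simp only [seqNorm_eq, mul_add]
  exact eLpNorm_ennreal_add_le (by fun_prop) (by fun_prop) hq

theorem seqNorm_const_mul {s : ℝ} {q : ℝ≥0∞} (hq : 1 ≤ q) (c : ℝ≥0∞) (a : ℤ → ℝ≥0∞) :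
    seqNorm s q (fun j => c * a j) = c * seqNorm s q a := by
  simp only [seqNorm_eq, mul_left_comm _ c]
  exact eLpNorm_ennreal_const_mul hq (by fun_prop) c

theorem seqNorm_pow2_mul (s r : ℝ) (q : ℝ≥0∞) (a : ℤ → ℝ≥0∞) :
    seqNorm s q (fun j => pow2 (j * r) * a j) = seqNorm (s + r) q a := by
  simp only [seqNorm_eq, mul_add, pow2_add, mul_assoc]

theorem le_seqNorm {s : ℝ} {q : ℝ≥0∞} (hq : 1 ≤ q) (a : ℤ → ℝ≥0∞) (j : ℤ) :
    pow2 (j * s) * a j ≤ seqNorm s q a := by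
  rw [seqNorm_eq]
  rcases eq_or_ne q ∞ with rfl | hqt
  · rw [eLpNorm_ennreal_top]
    have := ENNReal.ae_le_essSup (μ := (Measure.count : Measure ℤ)) (fun j : ℤ => pow2 (j * s) * a j)
    rw [Measure.ae_count_iff] at this
    exact this j
  · have hq0 : q ≠ 0 := (zero_lt_one.trans_le hq).ne'
    have hr : 0 < q.toReal := ENNReal.toReal_pos hq0 hqt
    rw [eLpNorm_ennreal_eq hq0 hqt, one_div, ENNReal.le_rpow_inv_iff hr, lintegral_count]
    exact ENNReal.le_tsum j

/-- The one-sided geometric sequence `2 ^ (-mδ)`, `m ≥ 0`. -/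
def geo (δ : ℝ) (m : ℤ) : ℝ≥0∞ := if 0 ≤ m then pow2 (-(m * δ)) else 0

theorem tsum_geo_ne_top {δ : ℝ} (hδ : 0 < δ) : ∑' m, geo δ m ≠ ∞ := by
  have hinj : Function.Injective ((↑) : ℕ → ℤ) := Nat.cast_injective
  rw [← hinj.tsum_eq (f := geo δ)]
  · have : ∀ n : ℕ, geo δ (n : ℤ) = (pow2 (-δ)) ^ n := by
      intro n
      rw [geo, if_pos (by positivity), pow2, pow2, ← ENNReal.ofReal_pow (by positivity),
        ← Real.rpow_natCast, ← Real.rpow_mul two_pos.le]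
      congr 2; push_cast; ring
    simp_rw [this]
    rw [ENNReal.tsum_geometric]
    refine ENNReal.inv_ne_top.2 (tsub_pos_iff_lt.2 ?_).ne'
    rw [pow2, ENNReal.ofReal_lt_one]
    exact Real.rpow_lt_one_of_one_lt_of_neg one_lt_two (by linarith)
  · intro m hm
    have : 0 ≤ m := by
      by_contra h
      exact hm (by simp [geo, h])
    exact ⟨m.toNat, Int.toNat_of_nonneg this⟩

theorem tsum_geo_shift (δ : ℝ) (l : ℤ) : ∑' k, geo δ (l - k) = ∑' m, geo δ m :=
  (Equiv.subLeft l).tsum_eq (geo δ)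

theorem eLpNorm_count_shift (q : ℝ≥0∞) (b : ℤ → ℝ≥0∞) (m : ℤ) :
    eLpNorm (fun j : ℤ => b (j + m)) q Measure.count = eLpNorm b q Measure.count := by
  refine eLpNorm_comp_measurePreserving (g := b) (by fun_prop) ?_
  exact measurePreserving_add_right Measure.count m

/-- Young's inequality $\ell^1*\ell^q\subset\ell^q$. The shift by $2$ comes from the frequency
supports: a product at frequency $2^j$ sees only factors with $l\ge j-2$. -/
theorem seqNorm_geo_conv_le {s : ℝ} {q : ℝ≥0∞} (hq : 1 ≤ q) (σ : ℝ) (b : ℤ → ℝ≥0∞) :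
    seqNorm s q (fun j => pow2 (-(j * s)) * ∑' l : ℤ, geo σ (l - j + 2) * b l)
      ≤ (∑' m, geo σ m) * eLpNorm b q Measure.count := by
  have e : ∀ j : ℤ, pow2 (j * s) * (pow2 (-(j * s)) * ∑' l : ℤ, geo σ (l - j + 2) * b l)
      = ∑' m : ℤ, geo σ (m + 2) * b (j + m) := by
    intro j
    rw [← mul_assoc, pow2_mul_pow2_neg, one_mul, ← (Equiv.addLeft j).tsum_eq]
    simp
  rw [seqNorm_eq]
  simp_rw [e]
  refine (eLpNorm_tsum_le (g := fun (m j : ℤ) => geo σ (m + 2) * b (j + m)) hq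
    (fun i => by fun_prop)).trans ?_
  have : ∀ m : ℤ, eLpNorm (fun j => geo σ (m + 2) * b (j + m)) q Measure.count
      = geo σ (m + 2) * eLpNorm b q Measure.count := by
    intro m
    rw [eLpNorm_ennreal_const_mul hq (by fun_prop), eLpNorm_count_shift]
  simp_rw [this]
  rw [ENNReal.tsum_mul_right]
  exact (congrArg (· * _) ((Equiv.addRight (2 : ℤ)).tsum_eq (geo σ))).le

/-! ### Dyadic blocks and Bernstein's inequality. -/

/-- `|φ_j|`. -/
def cut (φ : 𝓢(R3, ℝ)) (j : ℤ) (ξ : R3) : ℝ≥0∞ := ‖φ ((2 : ℝ) ^ (-j) • ξ)‖ₑ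

/-- `‖φ_j g‖_{L^p}` for a nonnegative function. -/
def blk (φ : 𝓢(R3, ℝ)) (p : ℝ≥0∞) (j : ℤ) (g : R3 → ℝ≥0∞) : ℝ≥0∞ :=
  eLpNorm (fun ξ => cut φ j ξ * g ξ) p volume

theorem block_eq_blk (φ : 𝓢(R3, ℝ)) (p : ℝ≥0∞) (j : ℤ) (g : R3 → C3) :
    block φ p j g = blk φ p j fun ξ => ‖g ξ‖ₑ := by
  refine eLpNorm_congr_enorm_ae (Eventually.of_forall fun ξ => ?_)
  simp [cut, enorm_smul]

theorem measurable_cut (φ : 𝓢(R3, ℝ)) (j : ℤ) : Measurable (cut φ j) := by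
  unfold cut
  exact ((φ.continuous.comp (continuous_const_smul _)).measurable).enorm

theorem norm_bounds_of_cut_ne_zero {φ : 𝓢(R3, ℝ)} (hφ : IsLittlewoodPaley φ) {j : ℤ} {ξ : R3}
    (h : cut φ j ξ ≠ 0) : 3 / 4 * (2 : ℝ) ^ j ≤ ‖ξ‖ ∧ ‖ξ‖ ≤ 8 / 3 * (2 : ℝ) ^ j := by
  have h0 : φ ((2 : ℝ) ^ (-j) • ξ) ≠ 0 := by
    intro h0; exact h (by rw [cut, h0, enorm_zero])
  have h1 := hφ.supp _ h0
  have hpos : (0 : ℝ) < 2 ^ j := by positivity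
  rw [norm_smul, norm_zpow, Real.norm_ofNat, zpow_neg] at h1
  constructor
  · have := mul_le_mul_of_nonneg_left h1.1 hpos.le
    rw [← mul_assoc, mul_inv_cancel₀ hpos.ne', one_mul] at this; linarith
  · have := mul_le_mul_of_nonneg_left h1.2 hpos.le
    rw [← mul_assoc, mul_inv_cancel₀ hpos.ne', one_mul] at this; linarith

theorem exists_cut_le (φ : 𝓢(R3, ℝ)) : ∃ C : ℝ≥0∞, C ≠ ∞ ∧ ∀ j ξ, cut φ j ξ ≤ C := by
  refine ⟨ENNReal.ofReal (SchwartzMap.seminorm ℝ 0 0 φ), ENNReal.ofReal_ne_top, fun j ξ => ?_⟩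
  rw [cut, ← ofReal_norm]
  exact ENNReal.ofReal_le_ofReal (φ.norm_le_seminorm ℝ _)

/-- Only an inequality, because `φ` may change sign. It is enough for upper bounds of nonnegative
functions. -/
theorem one_le_tsum_cut {φ : 𝓢(R3, ℝ)} (hφ : IsLittlewoodPaley φ) {ξ : R3} (hξ : ξ ≠ 0) :
    1 ≤ ∑' j, cut φ j ξ := by
  have h := hφ.partition ξ hξ
  have : ‖(1 : ℝ)‖ₑ ≤ ∑' j, cut φ j ξ := by
    refine le_of_tendsto h.enorm (Eventually.of_forall fun s => ?_)
    exact (enorm_sum_le _ _).trans (ENNReal.sum_le_tsum s)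
  simpa using this

theorem blk_mono_ae {φ : 𝓢(R3, ℝ)} {p : ℝ≥0∞} {j : ℤ} {f g : R3 → ℝ≥0∞}
    (h : ∀ᵐ ξ, f ξ ≤ g ξ) : blk φ p j f ≤ blk φ p j g :=
  eLpNorm_ennreal_mono_ae (by filter_upwards [h] with ξ h; gcongr)

theorem blk_congr_ae {φ : 𝓢(R3, ℝ)} {p : ℝ≥0∞} {j : ℤ} {f g : R3 → ℝ≥0∞}
    (h : f =ᵐ[volume] g) : blk φ p j f = blk φ p j g :=
  le_antisymm (blk_mono_ae (h.mono fun _ h => h.le)) (blk_mono_ae (h.mono fun _ h => h.ge))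

theorem blk_add_le {φ : 𝓢(R3, ℝ)} {p : ℝ≥0∞} (hp : 1 ≤ p) {j : ℤ} {f g : R3 → ℝ≥0∞}
    (hf : AEMeasurable f) (hg : AEMeasurable g) :
    blk φ p j (fun ξ => f ξ + g ξ) ≤ blk φ p j f + blk φ p j g := by
  simp only [blk, mul_add]
  exact eLpNorm_ennreal_add_le ((measurable_cut φ j).aemeasurable.mul hf)
    ((measurable_cut φ j).aemeasurable.mul hg) hp

theorem blk_const_mul {φ : 𝓢(R3, ℝ)} {p : ℝ≥0∞} (hp : 1 ≤ p) {j : ℤ} {f : R3 → ℝ≥0∞}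
    (hf : AEMeasurable f) (c : ℝ≥0∞) :
    blk φ p j (fun ξ => c * f ξ) = c * blk φ p j f := by
  simp only [blk, mul_left_comm _ c]
  exact eLpNorm_ennreal_const_mul hp ((measurable_cut φ j).aemeasurable.mul hf) c

/-- **Bernstein's inequality** on a dyadic annulus. -/
theorem exists_lintegral_cut_le {φ : 𝓢(R3, ℝ)} (hφ : IsLittlewoodPaley φ) {p : ℝ≥0∞}
    (hp : 1 ≤ p) : ∃ C : ℝ≥0∞, C ≠ ∞ ∧ ∀ (j : ℤ) (f : R3 → ℝ≥0∞), AEMeasurable f →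
      ∫⁻ ξ, cut φ j ξ * f ξ ≤ C * pow2 (j * (3 - (3 / p).toReal)) * blk φ p j f := by
  -- The Hölder exponent on a ball of volume comparable to $2^{3j}$. For `p = ∞` the conventions
  -- `∞.toReal = 0` and `1 / 0 = 0` give the correct value $\beta=1$.
  set β : ℝ := 1 - 1 / p.toReal with hβ
  have hβ0 : 0 ≤ β := by
    rw [hβ, sub_nonneg]
    rcases eq_or_ne p ∞ with rfl | hpt
    · simp
    · rw [div_le_one (ENNReal.toReal_pos (zero_lt_one.trans_le hp).ne' hpt)]
      rw [← ENNReal.toReal_one]; exact ENNReal.toReal_mono hpt hp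
  have h3 : 3 - (3 / p).toReal = 3 * β := by
    rw [hβ, ENNReal.toReal_div]; simp; ring
  set v : ℝ≥0∞ := volume (Metric.closedBall (0 : R3) (8 / 3)) with hv
  have hvt : v ≠ ∞ := (isCompact_closedBall _ _).measure_lt_top.ne
  refine ⟨v ^ β, ENNReal.rpow_ne_top_of_nonneg hβ0 hvt, fun j f hf => ?_⟩
  have hpos : (0 : ℝ) < 2 ^ j := by positivity
  set S := Metric.closedBall (0 : R3) (2 ^ j * (8 / 3)) with hS
  have hvol : volume S = pow2 (j * 3) * v := by
    rw [hS, Measure.addHaar_closedBall_mul_of_pos _ _ hpos]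
    congr 1
    simp only [finrank_euclideanSpace, Fintype.card_fin, pow2]
    rw [Real.rpow_mul two_pos.le, Real.rpow_intCast]; norm_cast
  have hF : AEMeasurable (fun ξ => cut φ j ξ * f ξ) := (measurable_cut φ j).aemeasurable.mul hf
  have e : ∫⁻ ξ, cut φ j ξ * f ξ = ∫⁻ ξ in S, cut φ j ξ * f ξ := by
    rw [setLIntegral_eq_of_support_subset]
    intro ξ hξ
    have : cut φ j ξ ≠ 0 := fun h => hξ (by simp [h])
    rw [hS, mem_closedBall_zero_iff, mul_comm]
    exact (norm_bounds_of_cut_ne_zero hφ this).2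
  have h := eLpNorm_le_eLpNorm_mul_rpow_measure_univ (μ := volume.restrict S) hp
    (f := fun ξ => cut φ j ξ * f ξ) hF.restrict.aestronglyMeasurable
  rw [eLpNorm_ennreal_one, ← e, Measure.restrict_apply_univ, hvol] at h
  refine h.trans ?_
  simp only [ENNReal.toReal_one, div_one]
  rw [← hβ, ENNReal.mul_rpow_of_nonneg _ _ hβ0, mul_comm]
  have e2 : pow2 (j * 3) ^ β = pow2 (j * (3 - (3 / p).toReal)) := by
    rw [h3, pow2, pow2, ENNReal.ofReal_rpow_of_nonneg (by positivity) hβ0,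
      ← Real.rpow_mul two_pos.le, mul_assoc]
  rw [e2, mul_comm (pow2 _)]
  gcongr
  exact eLpNorm_mono_measure _ Measure.restrict_le_self

/-! ### The product law in Fourier–Besov spaces. -/

theorem conv_congr_ae {f f' g g' : R3 → ℝ≥0∞} (hf : f =ᵐ[volume] f') (hg : g =ᵐ[volume] g') :
    conv f g = conv f' g' := by
  funext ξ
  refine lintegral_congr_ae ?_
  have : ∀ᵐ η, f (ξ - η) = f' (ξ - η) :=
    (Measure.measurePreserving_sub_left volume ξ).quasiMeasurePreserving.ae hf
  filter_upwards [this, hg] with η h1 h2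
  rw [h1, h2]

theorem measurable_conv {f g : R3 → ℝ≥0∞} (hf : Measurable f) (hg : Measurable g) :
    Measurable (conv f g) := by
  have : Measurable (Function.uncurry fun x y : R3 => f (x - y) * g y) :=
    (hf.comp (measurable_fst.sub measurable_snd)).mul (hg.comp measurable_snd)
  exact this.lintegral_prod_right'

/-- Insert the dyadic partition in both factors. It fails only at the origin of each factor, that is
for $\eta=\xi$ and $\eta=0$, a null set. -/
theorem conv_le_tsum_conv_cut {φ : 𝓢(R3, ℝ)} (hφ : IsLittlewoodPaley φ) {f g : R3 → ℝ≥0∞}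
    (hf : Measurable f) (hg : Measurable g) (ξ : R3) :
    conv f g ξ ≤ ∑' k, ∑' l, conv (fun η => cut φ k η * f η) (fun η => cut φ l η * g η) ξ := by
  have hk : ∀ k, Measurable fun η => cut φ k (ξ - η) * f (ξ - η) := fun k =>
    (((measurable_cut φ k).mul hf).comp (measurable_const.sub measurable_id))
  have hl : ∀ l, Measurable fun η => cut φ l η * g η := fun l => (measurable_cut φ l).mul hg
  unfold conv
  have e : ∀ k, ∑' l, ∫⁻ η, (cut φ k (ξ - η) * f (ξ - η)) * (cut φ l η * g η)
      = ∫⁻ η, ∑' l, (cut φ k (ξ - η) * f (ξ - η)) * (cut φ l η * g η) := fun k =>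
    (lintegral_tsum fun l => ((hk k).mul (hl l)).aemeasurable).symm
  simp_rw [e]
  rw [← lintegral_tsum (f := fun k η => ∑' l, (cut φ k (ξ - η) * f (ξ - η)) * (cut φ l η * g η))
    fun k => (Measurable.tsum fun l => (hk k).mul (hl l)).aemeasurable]
  refine lintegral_mono_ae ?_
  filter_upwards [Measure.ae_ne volume (0 : R3), Measure.ae_ne volume ξ] with η h0 h1
  simp_rw [ENNReal.tsum_mul_left, ENNReal.tsum_mul_right]
  have h2 := one_le_tsum_cut hφ (sub_ne_zero.2 (Ne.symm h1))
  have h3 := one_le_tsum_cut hφ h0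
  calc f (ξ - η) * g η = (1 * f (ξ - η)) * (1 * g η) := by simp
    _ ≤ _ := by gcongr

/-- If $k,l\le j-3$, the sum of two supported frequencies has length at most
$2\cdot\frac83\cdot2^{j-3}=\frac23 2^j$, below the inner radius $\frac34 2^j$ of block $j$. -/
theorem cut_mul_conv_cut_eq_zero {φ : 𝓢(R3, ℝ)} (hφ : IsLittlewoodPaley φ) (f g : R3 → ℝ≥0∞)
    {j k l : ℤ} (h : max k l + 2 < j) (ξ : R3) :
    cut φ j ξ * conv (fun η => cut φ k η * f η) (fun η => cut φ l η * g η) ξ = 0 := by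
  by_cases hj : cut φ j ξ = 0
  · simp [hj]
  have : ∀ η, (cut φ k (ξ - η) * f (ξ - η)) * (cut φ l η * g η) = 0 := by
    intro η
    by_cases hk : cut φ k (ξ - η) = 0
    · simp [hk]
    by_cases hl : cut φ l η = 0
    · simp [hl]
    exfalso
    have h1 := (norm_bounds_of_cut_ne_zero hφ hj).1
    have h2 := (norm_bounds_of_cut_ne_zero hφ hk).2
    have h3 := (norm_bounds_of_cut_ne_zero hφ hl).2
    have h4 : ‖ξ‖ ≤ ‖ξ - η‖ + ‖η‖ := by simpa using norm_add_le (ξ - η) η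
    have h5 : (2 : ℝ) ^ k ≤ 2 ^ (j - 3) := zpow_le_zpow_right₀ one_le_two (by
      have := le_max_left k l; omega)
    have h6 : (2 : ℝ) ^ l ≤ 2 ^ (j - 3) := zpow_le_zpow_right₀ one_le_two (by
      have := le_max_right k l; omega)
    have h7 : (2 : ℝ) ^ (j - 3) = 2 ^ j / 8 := by
      rw [zpow_sub₀ two_ne_zero]; norm_num
    have : (0 : ℝ) < 2 ^ j := by positivity
    linarith
  simp [conv, this]

/-- The part of the product in which the first factor has the lower frequency. -/
def paraSum (φ : 𝓢(R3, ℝ)) (p : ℝ≥0∞) (f g : R3 → ℝ≥0∞) (j : ℤ) : ℝ≥0∞ :=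
  ∑' k : ℤ, ∑' l : ℤ, if k ≤ l ∧ j ≤ l + 2 then
    eLpNorm (conv (fun η => cut φ k η * f η) (fun η => cut φ l η * g η)) p volume else 0

/-- A two-term paraproduct: each pair $(k,l)$ goes to the sum in which its larger index is the high
frequency. The diagonal is counted twice, which an upper bound allows. -/
theorem exists_blk_conv_le_paraSum {φ : 𝓢(R3, ℝ)} (hφ : IsLittlewoodPaley φ) {p : ℝ≥0∞}
    (hp : 1 ≤ p) : ∃ C : ℝ≥0∞, C ≠ ∞ ∧ ∀ (j : ℤ) (f g : R3 → ℝ≥0∞), Measurable f → Measurable g →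
      blk φ p j (conv f g) ≤ C * (paraSum φ p f g j + paraSum φ p g f j) := by
  obtain ⟨C, hC, hcut⟩ := exists_cut_le φ
  refine ⟨C, hC, fun j f g hf hg => ?_⟩
  set P : ℤ → ℤ → R3 → ℝ≥0∞ := fun k l =>
    conv (fun η => cut φ k η * f η) (fun η => cut φ l η * g η) with hP
  have hPm : ∀ k l, Measurable (P k l) := fun k l =>
    measurable_conv ((measurable_cut φ k).mul hf) ((measurable_cut φ l).mul hg)
  have h1 : blk φ p j (conv f g) ≤ ∑' k, ∑' l, blk φ p j (P k l) := by
    calc blk φ p j (conv f g)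
        ≤ eLpNorm (fun ξ => ∑' k, ∑' l, cut φ j ξ * P k l ξ) p volume := by
          refine eLpNorm_ennreal_mono fun ξ => ?_
          simp_rw [ENNReal.tsum_mul_left]
          gcongr
          exact conv_le_tsum_conv_cut hφ hf hg ξ
      _ ≤ ∑' k, eLpNorm (fun ξ => ∑' l, cut φ j ξ * P k l ξ) p volume :=
          eLpNorm_tsum_le hp fun k => Measurable.tsum fun l =>
            (measurable_cut φ j).mul (hPm k l)
      _ ≤ _ := ENNReal.tsum_le_tsum fun k =>
          eLpNorm_tsum_le hp fun l => (measurable_cut φ j).mul (hPm k l)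
  refine h1.trans ?_
  have h2 : paraSum φ p g f j
      = ∑' k : ℤ, ∑' l : ℤ, if l ≤ k ∧ j ≤ k + 2 then eLpNorm (P k l) p volume else 0 := by
    rw [paraSum, ENNReal.tsum_comm]
    simp_rw [hP, conv_comm]
  rw [h2, paraSum, ← ENNReal.tsum_add, ← ENNReal.tsum_mul_left]
  refine ENNReal.tsum_le_tsum fun k => ?_
  rw [← ENNReal.tsum_add, ← ENNReal.tsum_mul_left]
  refine ENNReal.tsum_le_tsum fun l => ?_
  by_cases hj : max k l + 2 < j
  · have : blk φ p j (P k l) = 0 := by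
      rw [blk]
      have : (fun ξ => cut φ j ξ * P k l ξ) = 0 :=
        funext fun ξ => cut_mul_conv_cut_eq_zero hφ f g hj ξ
      rw [this]; simp
    rw [this]; exact zero_le
  · have h3 : blk φ p j (P k l) ≤ C * eLpNorm (P k l) p volume := by
      rw [← eLpNorm_ennreal_const_mul hp (hPm k l).aemeasurable]
      exact eLpNorm_ennreal_mono fun ξ => by gcongr; exact hcut j ξ
    refine h3.trans ?_
    gcongr
    rcases le_total k l with hkl | hkl
    · rw [max_eq_right hkl] at hj
      rw [if_pos ⟨hkl, by omega⟩]
      exact le_self_add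
    · rw [max_eq_left hkl] at hj
      rw [if_pos (c := l ≤ k ∧ _) ⟨hkl, by omega⟩]
      exact le_add_self

/-- Bernstein gives the low factor an $L^1$ norm of at most $C2^{k\delta}A$; Young keeps the high
factor in $L^p$. Since $\delta>0$, the sum over $k\le l$ is geometric with top term $2^{l\delta}$.
What remains in $l$ has weight $2^{-l(s-\delta)}$ on $l\ge j-2$, a one-sided geometric convolution.
The low factor enters only through a supremum over its blocks. -/
theorem exists_paraSum_le {φ : 𝓢(R3, ℝ)} (hφ : IsLittlewoodPaley φ) {p : ℝ≥0∞} (hp : 1 ≤ p)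
    {s δ : ℝ} (hδ : 0 < δ) (hδs : δ = 3 - (3 / p).toReal - s) :
    ∃ C : ℝ≥0∞, C ≠ ∞ ∧ ∀ (a b : ℤ → ℝ≥0∞) (A : ℝ≥0∞), (∀ k : ℤ, pow2 (k * s) * a k ≤ A) →
      ∀ (f g : R3 → ℝ≥0∞), Measurable f → Measurable g → (∀ k, blk φ p k f ≤ a k) →
      (∀ k, blk φ p k g ≤ b k) → ∀ j : ℤ, paraSum φ p f g j ≤
        C * A * (pow2 (-(j * (s - δ))) *
          ∑' l : ℤ, geo (s - δ) (l - j + 2) * (pow2 (l * s) * b l)) := by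
  obtain ⟨C, hC, hB⟩ := exists_lintegral_cut_le hφ hp
  -- The factor $2^{2(s-\delta)}$ compensates the shift by $2$ in the geometric weight.
  refine ⟨C * (∑' m, geo δ m) * pow2 (2 * (s - δ)),
    ENNReal.mul_ne_top (ENNReal.mul_ne_top hC (tsum_geo_ne_top hδ)) (pow2_ne_top _),
    fun a b A hA f g hf hg hfa hgb j => ?_⟩
  have key : ∀ k l : ℤ, (if k ≤ l ∧ j ≤ l + 2 then
      eLpNorm (conv (fun η => cut φ k η * f η) (fun η => cut φ l η * g η)) p volume else 0)
      ≤ geo δ (l - k) * ((C * A * pow2 (2 * (s - δ))) * (pow2 (-(j * (s - δ))) *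
        (geo (s - δ) (l - j + 2) * (pow2 (l * s) * b l)))) := by
    intro k l
    split_ifs with h
    · rw [conv_comm]
      have hl : eLpNorm (fun η => cut φ l η * g η) p volume
          ≤ pow2 (-(l * s)) * (pow2 (l * s) * b l) := by
        rw [← mul_assoc, pow2_neg_mul_pow2, one_mul]; exact hgb l
      have hk : ∫⁻ η, cut φ k η * f η ≤ C * pow2 (k * δ) * A := by
        refine (hB k f hf.aemeasurable).trans ?_
        have : pow2 (k * (3 - (3 / p).toReal)) = pow2 (k * δ) * pow2 (k * s) := by
          rw [← pow2_add, hδs]; congr 1; ring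
        rw [this, mul_assoc, mul_assoc, mul_assoc]
        gcongr
        exact (mul_le_mul_right (hfa k) _).trans (hA k)
      refine (eLpNorm_conv_le hp ((measurable_cut φ l).mul hg)
        ((measurable_cut φ k).mul hf)).trans ?_
      refine (mul_le_mul' hl hk).trans (le_of_eq ?_)
      rw [geo, if_pos (by omega), geo, if_pos (by omega)]
      have e : pow2 (-(l * s)) * pow2 (k * δ) = pow2 (-((l - k : ℤ) * δ)) * (pow2 (2 * (s - δ)) *
          (pow2 (-(j * (s - δ))) * pow2 (-((l - j + 2 : ℤ) * (s - δ))))) := by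
        simp only [← pow2_add]; congr 1; push_cast; ring
      calc _ = (pow2 (-(l * s)) * pow2 (k * δ)) * (C * A * (pow2 (l * s) * b l)) := by ring
        _ = _ := by rw [e]; ring
    · exact zero_le
  calc paraSum φ p f g j ≤ ∑' k : ℤ, ∑' l : ℤ, geo δ (l - k) * ((C * A * pow2 (2 * (s - δ))) *
        (pow2 (-(j * (s - δ))) * (geo (s - δ) (l - j + 2) * (pow2 (l * s) * b l)))) :=
        ENNReal.tsum_le_tsum fun k => ENNReal.tsum_le_tsum fun l => key k l
    _ = _ := by
        rw [ENNReal.tsum_comm]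
        simp_rw [ENNReal.tsum_mul_right, tsum_geo_shift, ENNReal.tsum_mul_left]
        ring

/-- The product law `FḂ^s × FḂ^s → FḂ^σ`, `σ = 2s - 3 + 3/p`, in terms of block majorants. -/
theorem exists_conv_majorant {φ : 𝓢(R3, ℝ)} (hφ : IsLittlewoodPaley φ) {p q : ℝ≥0∞} (hp : 1 ≤ p)
    (hq : 1 ≤ q) {s σ : ℝ} (hs : s < 3 - (3 / p).toReal) (hσ : 0 < σ)
    (hσs : σ = 2 * s - (3 - (3 / p).toReal)) :
    ∃ C : ℝ≥0∞, C ≠ ∞ ∧ ∀ a b : ℤ → ℝ≥0∞, ∃ c : ℤ → ℝ≥0∞,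
      seqNorm σ q c ≤ C * seqNorm s q a * seqNorm s q b ∧
      ∀ f g : R3 → ℝ≥0∞, AEMeasurable f → AEMeasurable g → (∀ k, blk φ p k f ≤ a k) →
        (∀ k, blk φ p k g ≤ b k) → ∀ j, blk φ p j (conv f g) ≤ c j := by
  obtain ⟨C₁, hC₁, h₁⟩ := exists_blk_conv_le_paraSum hφ hp
  obtain ⟨C₂, hC₂, h₂⟩ := exists_paraSum_le hφ hp (sub_pos.2 hs) rfl
  have hσ' : s - (3 - (3 / p).toReal - s) = σ := by rw [hσs]; ring
  rw [hσ'] at h₂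
  set G := ∑' m, geo σ m with hG
  have hGt : G ≠ ∞ := tsum_geo_ne_top hσ
  -- `G` sums the high frequencies; the factor $2$ counts the two paraproducts.
  refine ⟨C₁ * (C₂ * G * 2), by finiteness, fun a b => ?_⟩
  let Q : (ℤ → ℝ≥0∞) → ℤ → ℝ≥0∞ := fun b j =>
    pow2 (-(j * σ)) * ∑' l : ℤ, geo σ (l - j + 2) * (pow2 (l * s) * b l)
  have hQ : ∀ b, seqNorm σ q (Q b) ≤ G * seqNorm s q b := fun b =>
    seqNorm_geo_conv_le hq σ (fun l => pow2 (l * s) * b l)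
  refine ⟨fun j => C₁ * (C₂ * seqNorm s q a * Q b j + C₂ * seqNorm s q b * Q a j), ?_, ?_⟩
  · rw [seqNorm_const_mul hq]
    calc _ ≤ C₁ * (C₂ * seqNorm s q a * (G * seqNorm s q b) +
          C₂ * seqNorm s q b * (G * seqNorm s q a)) := by
          gcongr
          refine (seqNorm_add_le hq _ _).trans ?_
          rw [seqNorm_const_mul hq, seqNorm_const_mul hq]
          gcongr
          · exact hQ b
          · exact hQ a
      _ = _ := by ring
  · intro f g hf hg hfa hgb j
    rw [conv_congr_ae hf.ae_eq_mk hg.ae_eq_mk]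
    have hfa' : ∀ k, blk φ p k (hf.mk f) ≤ a k := fun k => by
      rw [← blk_congr_ae hf.ae_eq_mk]; exact hfa k
    have hgb' : ∀ k, blk φ p k (hg.mk g) ≤ b k := fun k => by
      rw [← blk_congr_ae hg.ae_eq_mk]; exact hgb k
    refine (h₁ j _ _ hf.measurable_mk hg.measurable_mk).trans ?_
    refine mul_le_mul' le_rfl (add_le_add ?_ ?_)
    · exact h₂ a b _ (fun k => le_seqNorm hq a k) _ _ hf.measurable_mk hg.measurable_mk hfa' hgb' j
    · exact h₂ b a _ (fun k => le_seqNorm hq b k) _ _ hg.measurable_mk hf.measurable_mk hgb' hfa' j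

/-! ### Tails in time and the Duhamel integral. -/

/-- Lebesgue measure on `(0, ∞)`. -/
abbrev posTime : Measure ℝ := (volume : Measure ℝ).restrict (Ioi 0)

theorem ae_aemeasurable_section {α β γ : Type*} [MeasurableSpace α] [MeasurableSpace β]
    [MeasurableSpace γ] {μ : Measure α} {ν : Measure β} [SFinite ν] {g : α → β → γ}
    (hg : AEMeasurable (Function.uncurry g) (μ.prod ν)) : ∀ᵐ y ∂μ, AEMeasurable (g y) ν := by
  obtain ⟨G, hG, hGe⟩ := hg
  filter_upwards [Measure.ae_ae_of_ae_prod hGe] with y hy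
  exact ⟨fun x => G (y, x), hG.comp (measurable_const.prodMk measurable_id), hy⟩

theorem ae_aemeasurable_section_right {α β γ : Type*} [MeasurableSpace α] [MeasurableSpace β]
    [MeasurableSpace γ] {μ : Measure α} {ν : Measure β} [SFinite μ] [SFinite ν] {g : α → β → γ}
    (hg : AEMeasurable (Function.uncurry g) (μ.prod ν)) :
    ∀ᵐ x ∂ν, AEMeasurable (fun y => g y x) μ :=
  ae_aemeasurable_section (g := fun x y => g y x) hg.prod_swap

theorem ae_restrict_Ioc_of_posTime {P : ℝ → Prop} {t : ℝ} (h : ∀ᵐ τ ∂posTime, P τ) :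
    ∀ᵐ τ ∂(volume : Measure ℝ).restrict (Ioc 0 t), P τ :=
  ae_mono (Measure.restrict_mono Ioc_subset_Ioi_self le_rfl) h

theorem restrict_Ioc_prod_absolutelyContinuous (t : ℝ) :
    ((volume : Measure ℝ).restrict (Ioc 0 t)).prod (volume : Measure R3) ≪
      posTime.prod volume :=
  (Measure.absolutelyContinuous_of_le
    (Measure.restrict_mono Ioc_subset_Ioi_self le_rfl)).prod Measure.AbsolutelyContinuous.rfl

/-- `ess sup_{t > T} ‖φ_j g(t)‖_{L^p}`. -/
def tail (φ : 𝓢(R3, ℝ)) (p : ℝ≥0∞) (T : ℝ) (g : ℝ → R3 → ℝ≥0∞) (j : ℤ) : ℝ≥0∞ :=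
  essSup (fun t => blk φ p j (g t)) ((volume : Measure ℝ).restrict (Ioi T))

theorem ae_blk_le_tail (φ : 𝓢(R3, ℝ)) (p : ℝ≥0∞) (T : ℝ) (g : ℝ → R3 → ℝ≥0∞) :
    ∀ᵐ t ∂(volume : Measure ℝ).restrict (Ioi T), ∀ j, blk φ p j (g t) ≤ tail φ p T g j :=
  ae_all_iff.2 fun _ => ENNReal.ae_le_essSup _

theorem tail_anti (φ : 𝓢(R3, ℝ)) (p : ℝ≥0∞) {T T' : ℝ} (h : T ≤ T') (g : ℝ → R3 → ℝ≥0∞) (j : ℤ) :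
    tail φ p T' g j ≤ tail φ p T g j :=
  essSup_mono_measure' (Measure.restrict_mono (Ioi_subset_Ioi h) le_rfl)

theorem tail_le_of_ae {φ : 𝓢(R3, ℝ)} {p : ℝ≥0∞} {T : ℝ} {g : ℝ → R3 → ℝ≥0∞} {j : ℤ} {c : ℝ≥0∞}
    (h : ∀ᵐ t ∂(volume : Measure ℝ).restrict (Ioi T), blk φ p j (g t) ≤ c) : tail φ p T g j ≤ c :=
  essSup_le_of_ae_le _ h

theorem tail_congr_ae {φ : 𝓢(R3, ℝ)} {p : ℝ≥0∞} {T : ℝ} {f g : ℝ → R3 → ℝ≥0∞} {j : ℤ}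
    (h : ∀ t > T, f t =ᵐ[volume] g t) : tail φ p T f j = tail φ p T g j := by
  refine essSup_congr_ae ?_
  filter_upwards [ae_restrict_mem measurableSet_Ioi] with t ht
  exact blk_congr_ae (h t ht)

/-- The Duhamel integral of a nonnegative function, with the fractional heat kernel only. -/
def duhamel (ν α : ℝ) (g : ℝ → R3 → ℝ≥0∞) (t : ℝ) (ξ : R3) : ℝ≥0∞ :=
  ∫⁻ τ in Ioc 0 t, ENNReal.ofReal (Real.exp (-ν * (t - τ) * ‖ξ‖ ^ (2 * α))) * g τ ξ

theorem measurable_heatKernel {α : ℝ} (hα : 0 < α) (ν t : ℝ) : Measurable fun z : ℝ × R3 =>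
    ENNReal.ofReal (Real.exp (-ν * (t - z.1) * ‖z.2‖ ^ (2 * α))) := by
  have h2 : Continuous fun z : ℝ × R3 => ‖z.2‖ ^ (2 * α) :=
    (continuous_snd.norm).rpow_const fun _ => Or.inr (by positivity)
  have : Continuous fun z : ℝ × R3 => Real.exp (-ν * (t - z.1) * ‖z.2‖ ^ (2 * α)) := by fun_prop
  exact this.measurable.ennreal_ofReal

theorem aemeasurable_duhamel {α : ℝ} (hα : 0 < α) (ν t : ℝ) {g : ℝ → R3 → ℝ≥0∞}
    (hg : AEMeasurable (Function.uncurry g) (posTime.prod volume)) :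
    AEMeasurable (duhamel ν α g t) := by
  have h := (measurable_heatKernel hα ν t).aemeasurable.mul
    (hg.mono_ac (restrict_Ioc_prod_absolutelyContinuous t))
  exact h.prod_swap.lintegral_prod_right'

theorem lintegral_exp_le {l : ℝ} (hl : 0 < l) (t : ℝ) :
    ∫⁻ τ in Ioc 0 t, ENNReal.ofReal (Real.exp (-(l * (t - τ)))) ≤ ENNReal.ofReal l⁻¹ := by
  rcases lt_or_ge t 0 with ht | ht
  · simp [Ioc_eq_empty (not_lt.2 ht.le)]
  have hc : Continuous fun τ : ℝ => Real.exp (-(l * (t - τ))) := by fun_prop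
  rw [← ofReal_integral_eq_lintegral_ofReal hc.integrableOn_Ioc
    (Eventually.of_forall fun _ => (Real.exp_pos _).le)]
  refine ENNReal.ofReal_le_ofReal ?_
  rw [← intervalIntegral.integral_of_le ht]
  have hd : ∀ x ∈ uIcc 0 t, HasDerivAt (fun τ : ℝ => l⁻¹ * Real.exp (-(l * (t - τ))))
      (Real.exp (-(l * (t - x)))) x := by
    intro x _
    have h1 : HasDerivAt (fun τ : ℝ => -(l * (t - τ))) l x := by
      have := ((hasDerivAt_id' x).const_mul l).add_const (-(l * t))
      rw [mul_one] at this
      exact this.congr_of_eventuallyEq (Eventually.of_forall fun τ => by ring)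
    have := h1.exp.const_mul l⁻¹
    rwa [mul_left_comm, inv_mul_cancel₀ hl.ne', mul_one] at this
  rw [intervalIntegral.integral_eq_sub_of_hasDerivAt hd (hc.intervalIntegrable _ _)]
  simp only [sub_self, mul_zero, neg_zero, Real.exp_zero, mul_one]
  have : 0 < l⁻¹ * Real.exp (-(l * (t - 0))) := by positivity
  linarith

theorem exp_neg_le_inv {x : ℝ} (hx : 0 < x) : Real.exp (-x) ≤ x⁻¹ := by
  rw [Real.exp_neg]
  exact inv_anti₀ hx (by linarith [Real.add_one_le_exp x])

/-- On block $j$ the heat kernel is at most $e^{-l(t-\tau)}$ with $l=\nu(3/4)^{2\alpha}2^{2\alpha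
j}$. Split at $\tau=T$. The recent part integrates to at most $l^{-1}$ times the tail after $T$. The
past lasts a time $T$, with kernel at most $e^{-l(t-T)}\le(l(t-T))^{-1}$. Both parts thus gain
$l^{-1}$, and the past keeps a weight $T/(t-T)$ that is uniform in $j$. -/
theorem blk_duhamel_le {φ : 𝓢(R3, ℝ)} (hφ : IsLittlewoodPaley φ) {p : ℝ≥0∞} (hp : 1 ≤ p)
    {ν α : ℝ} (hν : 0 < ν) (hα : 0 < α) {g : ℝ → R3 → ℝ≥0∞}
    (hg : AEMeasurable (Function.uncurry g) (posTime.prod volume)) {T t : ℝ} (hT : 0 ≤ T)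
    (ht : T < t) (j : ℤ) :
    blk φ p j (duhamel ν α g t) ≤ ENNReal.ofReal (ν * (3 / 4) ^ (2 * α))⁻¹ *
      (pow2 (j * -(2 * α)) *
        (tail φ p T g j + ENNReal.ofReal (T / (t - T)) * tail φ p 0 g j)) := by
  set κ := ν * (3 / 4 : ℝ) ^ (2 * α) with hκ
  have hκ0 : 0 < κ := by positivity
  set l := κ * 2 ^ (j * (2 * α)) with hl
  have hl0 : 0 < l := by positivity
  set E : ℝ → ℝ≥0∞ := fun τ => ENNReal.ofReal (Real.exp (-(l * (t - τ)))) with hE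
  have hEm : Measurable E := by
    have hc : Continuous fun τ : ℝ => Real.exp (-(l * (t - τ))) := by fun_prop
    exact hc.measurable.ennreal_ofReal
  set A := tail φ p T g j
  set B := tail φ p 0 g j
  set μ := (volume : Measure ℝ).restrict (Ioc 0 t) with hμ
  have hkernel : ∀ τ ∈ Ioc 0 t, ∀ ξ, cut φ j ξ ≠ 0 →
      ENNReal.ofReal (Real.exp (-ν * (t - τ) * ‖ξ‖ ^ (2 * α))) ≤ E τ := by
    intro τ hτ ξ hξ
    refine ENNReal.ofReal_le_ofReal (Real.exp_le_exp.2 ?_)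
    have h1 := (norm_bounds_of_cut_ne_zero hφ hξ).1
    have h2 : (3 / 4 : ℝ) ^ (2 * α) * 2 ^ (j * (2 * α)) ≤ ‖ξ‖ ^ (2 * α) := by
      rw [Real.rpow_mul two_pos.le, Real.rpow_intCast, ← Real.mul_rpow (by positivity) (by positivity)]
      exact Real.rpow_le_rpow (by positivity) h1 (by positivity)
    have h3 : 0 ≤ ν * (t - τ) := mul_nonneg hν.le (sub_nonneg.2 hτ.2)
    have := mul_le_mul_of_nonneg_left h2 h3
    rw [hl, hκ]; linarith
  have hg' : AEMeasurable (Function.uncurry g) (μ.prod volume) :=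
    hg.mono_ac (restrict_Ioc_prod_absolutelyContinuous t)
  have hcg : AEMeasurable (Function.uncurry fun τ ξ => cut φ j ξ * g τ ξ) (μ.prod volume) :=
    ((measurable_cut φ j).comp measurable_snd).aemeasurable.mul hg'
  set n : ℝ → ℝ≥0∞ := fun τ => A * E τ +
    B * (Iic T).indicator (fun _ => ENNReal.ofReal (Real.exp (-(l * (t - T))))) τ with hn
  have hnm : Measurable n := (hEm.const_mul _).add
    ((measurable_const.indicator measurableSet_Iic).const_mul _)
  have h1 : blk φ p j (duhamel ν α g t)
      ≤ eLpNorm (fun ξ => ∫⁻ τ, E τ * (cut φ j ξ * g τ ξ) ∂μ) p volume := by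
    refine eLpNorm_ennreal_mono_ae ?_
    filter_upwards [ae_aemeasurable_section_right hcg] with ξ hm
    by_cases hξ : cut φ j ξ = 0
    · simp [hξ]
    rw [duhamel, ← lintegral_const_mul' _ _ (by simp [cut])]
    refine setLIntegral_mono_ae' measurableSet_Ioc (Eventually.of_forall fun τ hτ => ?_)
    rw [mul_left_comm]
    gcongr
    exact hkernel τ hτ ξ hξ
  have h2 : ∀ᵐ τ ∂μ, eLpNorm (fun ξ => E τ * (cut φ j ξ * g τ ξ)) p volume ≤ n τ := by
    have hB := ae_restrict_Ioc_of_posTime (t := t) (ae_blk_le_tail φ p 0 g)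
    have hA := ae_restrict_of_ae (s := Ioc 0 t)
      ((ae_restrict_iff' measurableSet_Ioi).1 (ae_blk_le_tail φ p T g))
    filter_upwards [hA, hB, ae_aemeasurable_section hcg] with τ hA hB hm
    rw [eLpNorm_ennreal_const_mul hp hm]
    change E τ * blk φ p j (g τ) ≤ _
    rcases lt_or_ge T τ with hτ | hτ
    · refine le_trans ?_ le_self_add
      rw [mul_comm]
      gcongr
      exact hA hτ j
    · refine le_trans ?_ le_add_self
      rw [mul_comm, indicator_of_mem (mem_Iic.2 hτ)]
      refine mul_le_mul' (hB j) (ENNReal.ofReal_le_ofReal (Real.exp_le_exp.2 ?_))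
      have := mul_le_mul_of_nonneg_left (sub_le_sub_left hτ t) hl0.le
      linarith
  have h3 := eLpNorm_lintegral_le hp (g := fun τ ξ => E τ * (cut φ j ξ * g τ ξ))
    (((hEm.comp measurable_fst).aemeasurable).mul hcg) hnm.aemeasurable h2
  refine (h1.trans h3).trans ?_
  have h4 : ENNReal.ofReal κ⁻¹ * pow2 (j * -(2 * α)) = ENNReal.ofReal l⁻¹ := by
    rw [pow2, ← ENNReal.ofReal_mul (by positivity), hl, mul_inv κ, mul_neg, Real.rpow_neg two_pos.le]
  have h5 : ∫⁻ τ, (Iic T).indicator (fun _ => ENNReal.ofReal (Real.exp (-(l * (t - T))))) τ ∂μ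
      ≤ ENNReal.ofReal l⁻¹ * ENNReal.ofReal (T / (t - T)) := by
    have htT : 0 < t - T := sub_pos.2 ht
    rw [lintegral_indicator_const measurableSet_Iic, hμ, Measure.restrict_apply measurableSet_Iic]
    have : volume (Iic T ∩ Ioc 0 t) ≤ ENNReal.ofReal T := by
      refine (measure_mono (t := Ioc 0 T) fun x hx => ⟨hx.2.1, hx.1⟩).trans ?_
      simp
    refine (mul_le_mul' le_rfl this).trans ?_
    rw [← ENNReal.ofReal_mul (by positivity), ← ENNReal.ofReal_mul (by positivity)]
    refine ENNReal.ofReal_le_ofReal ?_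
    calc _ ≤ (l * (t - T))⁻¹ * T := by gcongr; exact exp_neg_le_inv (by positivity)
      _ = _ := by field_simp
  rw [hn, lintegral_add_left (hEm.const_mul _), lintegral_const_mul _ hEm, lintegral_const_mul _
    (measurable_const.indicator measurableSet_Iic), ← mul_assoc, h4]
  calc _ ≤ A * ENNReal.ofReal l⁻¹ + B * (ENNReal.ofReal l⁻¹ * ENNReal.ofReal (T / (t - T))) := by
        gcongr
        exact lintegral_exp_le hl0 t
    _ = _ := by ring

/-- Duhamel's integral gains `2α` derivatives, and forgets its past. -/
theorem exists_duhamel_majorant {φ : 𝓢(R3, ℝ)} (hφ : IsLittlewoodPaley φ) {p q : ℝ≥0∞}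
    (hp : 1 ≤ p) (hq : 1 ≤ q) {ν α : ℝ} (hν : 0 < ν) (hα : 0 < α) :
    ∃ C : ℝ≥0∞, C ≠ ∞ ∧ ∀ (s : ℝ) (g : ℝ → R3 → ℝ≥0∞),
      AEMeasurable (Function.uncurry g) (posTime.prod volume) →
      ∀ (T : ℝ) (r : ℝ≥0∞), 0 ≤ T → ∀ a b : ℤ → ℝ≥0∞, (∀ j, tail φ p T g j ≤ a j) →
        (∀ j, tail φ p 0 g j ≤ b j) → ∃ c : ℤ → ℝ≥0∞,
        seqNorm s q c ≤ C * (seqNorm (s - 2 * α) q a + r * seqNorm (s - 2 * α) q b) ∧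
        ∀ t > T, ENNReal.ofReal (T / (t - T)) ≤ r → ∀ j, blk φ p j (duhamel ν α g t) ≤ c j := by
  refine ⟨ENNReal.ofReal (ν * (3 / 4) ^ (2 * α))⁻¹, ENNReal.ofReal_ne_top,
    fun s g hg T r hT a b ha hb => ?_⟩
  refine ⟨fun j => ENNReal.ofReal (ν * (3 / 4) ^ (2 * α))⁻¹ * (pow2 (j * -(2 * α)) *
    (a j + r * b j)), ?_, fun t ht hr j => ?_⟩
  · rw [seqNorm_const_mul hq, seqNorm_pow2_mul, ← sub_eq_add_neg]
    gcongr
    refine (seqNorm_add_le hq _ _).trans ?_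
    rw [seqNorm_const_mul hq]
  · refine (blk_duhamel_le hφ hp hν hα hg hT ht j).trans ?_
    exact mul_le_mul' le_rfl (mul_le_mul' le_rfl (add_le_add (ha j) (mul_le_mul' hr (hb j))))

/-- Bernstein makes each block integrable, and the blocks cover $\xi\ne0$. The finiteness is what
later allows Bochner integrals to be subtracted. -/
theorem ae_lt_top_of_blk {φ : 𝓢(R3, ℝ)} (hφ : IsLittlewoodPaley φ) {p : ℝ≥0∞} (hp : 1 ≤ p)
    {f : R3 → ℝ≥0∞} (hf : AEMeasurable f) (h : ∀ j, blk φ p j f ≠ ∞) : ∀ᵐ ξ, f ξ < ∞ := by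
  obtain ⟨C, hC, hB⟩ := exists_lintegral_cut_le hφ hp
  have h1 : ∀ᵐ ξ, ∀ j : ℤ, cut φ j ξ * f ξ < ∞ := ae_all_iff.2 fun j =>
    ae_lt_top' ((measurable_cut φ j).aemeasurable.mul hf) (ne_top_of_le_ne_top
      (ENNReal.mul_ne_top (ENNReal.mul_ne_top hC (pow2_ne_top _)) (h j)) (hB j f hf))
  filter_upwards [h1, Measure.ae_ne volume (0 : R3)] with ξ hξ h0
  obtain ⟨j, hj⟩ : ∃ j, cut φ j ξ ≠ 0 := by
    by_contra! hcon
    have := one_le_tsum_cut hφ h0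
    simp [hcon] at this
  rw [lt_top_iff_ne_top]
  intro htop
  have := hξ j
  rw [htop, ENNReal.mul_top hj] at this
  exact lt_irrefl _ this

/-! ### The bilinear estimate for nonnegative functions. -/

theorem blk_enorm_mul_le {φ : 𝓢(R3, ℝ)} (hφ : IsLittlewoodPaley φ) {p : ℝ≥0∞} (hp : 1 ≤ p)
    {f : R3 → ℝ≥0∞} (hf : AEMeasurable f) (j : ℤ) :
    blk φ p j (fun ξ => ‖ξ‖ₑ * f ξ) ≤ ENNReal.ofReal (8 / 3) * (pow2 (j * 1) * blk φ p j f) := by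
  rw [← mul_assoc, ← blk_const_mul hp hf]
  refine eLpNorm_ennreal_mono fun ξ => ?_
  by_cases hξ : cut φ j ξ = 0
  · simp [hξ]
  refine mul_le_mul' le_rfl (mul_le_mul' ?_ le_rfl)
  rw [← ofReal_norm, pow2, ← ENNReal.ofReal_mul (by positivity), mul_one, Real.rpow_intCast]
  exact ENNReal.ofReal_le_ofReal (norm_bounds_of_cut_ne_zero hφ hξ).2

theorem aemeasurable_conv {f g : ℝ → R3 → ℝ≥0∞}
    (hf : AEMeasurable (Function.uncurry f) (posTime.prod volume))
    (hg : AEMeasurable (Function.uncurry g) (posTime.prod volume)) :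
    AEMeasurable (Function.uncurry fun τ => conv (f τ) (g τ)) (posTime.prod volume) := by
  obtain ⟨F, hF, hFe⟩ := hf
  obtain ⟨G, hG, hGe⟩ := hg
  refine ⟨fun z => conv (fun ξ => F (z.1, ξ)) (fun ξ => G (z.1, ξ)) z.2, ?_, ?_⟩
  · have : Measurable (Function.uncurry fun (z : ℝ × R3) (η : R3) =>
        F (z.1, z.2 - η) * G (z.1, η)) := by
      refine (hF.comp ?_).mul (hG.comp ?_)
      · fun_prop
      · fun_prop
    exact this.lintegral_prod_right'
  · have h : ∀ᵐ τ ∂posTime, ∀ ξ, conv (f τ) (g τ) ξ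
        = conv (fun ξ => F (τ, ξ)) (fun ξ => G (τ, ξ)) ξ := by
      filter_upwards [Measure.ae_ae_of_ae_prod hFe, Measure.ae_ae_of_ae_prod hGe] with τ h1 h2 ξ
      exact congrFun (conv_congr_ae h1 h2) ξ
    filter_upwards [Measure.quasiMeasurePreserving_fst.ae h] with z hz using hz z.2

/-- The `𝓛^∞((T, ∞); FḂ^s_{p,q})` norm. -/
def tailNorm (φ : 𝓢(R3, ℝ)) (s : ℝ) (p q : ℝ≥0∞) (T : ℝ) (g : ℝ → R3 → ℝ≥0∞) : ℝ≥0∞ :=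
  seqNorm s q (tail φ p T g)

theorem tailNorm_anti (φ : 𝓢(R3, ℝ)) (s : ℝ) (p q : ℝ≥0∞) {T T' : ℝ} (h : T ≤ T')
    (g : ℝ → R3 → ℝ≥0∞) : tailNorm φ s p q T' g ≤ tailNorm φ s p q T g :=
  seqNorm_mono fun j => tail_anti φ p h g j

theorem tailNorm_add_le {φ : 𝓢(R3, ℝ)} {s : ℝ} {p q : ℝ≥0∞} (hp : 1 ≤ p) (hq : 1 ≤ q) {T : ℝ}
    (hT : 0 ≤ T) {f g : ℝ → R3 → ℝ≥0∞}
    (hf : AEMeasurable (Function.uncurry f) (posTime.prod volume))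
    (hg : AEMeasurable (Function.uncurry g) (posTime.prod volume)) :
    tailNorm φ s p q T (fun t ξ => f t ξ + g t ξ)
      ≤ tailNorm φ s p q T f + tailNorm φ s p q T g := by
  refine le_trans (seqNorm_mono fun j => ?_) (seqNorm_add_le hq _ _)
  refine tail_le_of_ae ?_
  have hmono : (volume : Measure ℝ).restrict (Ioi T) ≤ posTime :=
    Measure.restrict_mono (Ioi_subset_Ioi hT) le_rfl
  filter_upwards [ae_blk_le_tail φ p T f, ae_blk_le_tail φ p T g,
    ae_mono hmono (ae_aemeasurable_section hf), ae_mono hmono (ae_aemeasurable_section hg)]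
    with t h1 h2 h3 h4
  exact (blk_add_le hp h3 h4).trans (add_le_add (h1 j) (h2 j))

/-- The bilinear estimate, for nonnegative functions of `(t, ξ)`. -/
theorem exists_bilinear_majorant {φ : 𝓢(R3, ℝ)} (hφ : IsLittlewoodPaley φ) {p q : ℝ≥0∞}
    (hp : 1 ≤ p) (hq : 1 ≤ q) {ν α : ℝ} (hν : 0 < ν) (hα : 0 < α) {s : ℝ}
    (hs : s < 3 - (3 / p).toReal) (hσ : 0 < 2 * s - (3 - (3 / p).toReal))
    (hsα : s = 4 - 2 * α - (3 / p).toReal) :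
    ∃ C : ℝ≥0∞, C ≠ ∞ ∧ ∀ f g : ℝ → R3 → ℝ≥0∞,
      AEMeasurable (Function.uncurry f) (posTime.prod volume) →
      AEMeasurable (Function.uncurry g) (posTime.prod volume) →
      ∀ (T : ℝ) (r : ℝ≥0∞), 0 ≤ T → ∃ c : ℤ → ℝ≥0∞,
        seqNorm s q c ≤ C * (tailNorm φ s p q T f * tailNorm φ s p q T g +
          r * (tailNorm φ s p q 0 f * tailNorm φ s p q 0 g)) ∧
        ∀ t > T, ENNReal.ofReal (T / (t - T)) ≤ r → ∀ j,
          blk φ p j (duhamel ν α (fun τ ξ => ‖ξ‖ₑ * conv (f τ) (g τ) ξ) t) ≤ c j := by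
  obtain ⟨C₁, hC₁, h₁⟩ := exists_conv_majorant hφ (q := q) hp hq hs hσ rfl
  obtain ⟨C₂, hC₂, h₂⟩ := exists_duhamel_majorant hφ (q := q) hp hq hν hα
  refine ⟨C₂ * (ENNReal.ofReal (8 / 3) * C₁), by finiteness, fun f g hf hg T r hT => ?_⟩
  have hm : AEMeasurable (Function.uncurry fun τ ξ => ‖ξ‖ₑ * conv (f τ) (g τ) ξ)
      (posTime.prod volume) :=
    (measurable_enorm.comp measurable_snd).aemeasurable.mul (aemeasurable_conv hf hg)
  have key : ∀ T, 0 ≤ T → ∃ a : ℤ → ℝ≥0∞,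
      (∀ j, tail φ p T (fun τ ξ => ‖ξ‖ₑ * conv (f τ) (g τ) ξ) j ≤ a j) ∧
      seqNorm (s - 2 * α) q a ≤ ENNReal.ofReal (8 / 3) * C₁ *
        (tailNorm φ s p q T f * tailNorm φ s p q T g) := by
    intro T hT
    obtain ⟨c, hc, hc'⟩ := h₁ (tail φ p T f) (tail φ p T g)
    refine ⟨fun j => ENNReal.ofReal (8 / 3) * (pow2 (j * 1) * c j), fun j => ?_, ?_⟩
    · refine tail_le_of_ae ?_
      have hmono : (volume : Measure ℝ).restrict (Ioi T) ≤ posTime :=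
        Measure.restrict_mono (Ioi_subset_Ioi hT) le_rfl
      filter_upwards [ae_blk_le_tail φ p T f, ae_blk_le_tail φ p T g,
        ae_mono hmono (ae_aemeasurable_section hf), ae_mono hmono (ae_aemeasurable_section hg),
        ae_mono hmono (ae_aemeasurable_section (aemeasurable_conv hf hg))] with t h3 h4 h5 h6 h7
      refine (blk_enorm_mul_le hφ hp h7 j).trans ?_
      gcongr
      exact hc' _ _ h5 h6 h3 h4 j
    · rw [seqNorm_const_mul hq, seqNorm_pow2_mul]
      -- Criticality: one derivative is lost to the divergence and $2\alpha$ are gained from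
      -- Duhamel, which matches the product law exactly for $s=4-2\alpha-3/p$.
      have : s - 2 * α + 1 = 2 * s - (3 - (3 / p).toReal) := by rw [hsα]; ring
      rw [this, mul_assoc]
      gcongr
      rw [← mul_assoc]
      exact hc
  obtain ⟨a, ha, ha'⟩ := key T hT
  obtain ⟨b, hb, hb'⟩ := key 0 le_rfl
  obtain ⟨c, hc, hc'⟩ := h₂ s _ hm T r hT a b ha hb
  refine ⟨c, hc.trans ?_, hc'⟩
  calc _ ≤ C₂ * (ENNReal.ofReal (8 / 3) * C₁ * (tailNorm φ s p q T f * tailNorm φ s p q T g) +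
        r * (ENNReal.ofReal (8 / 3) * C₁ *
          (tailNorm φ s p q 0 f * tailNorm φ s p q 0 g))) := by gcongr
    _ = _ := by ring

/-! ### The Fourier transform as a function -/

/-- Real bump functions, rescaled by $2\pi$ to undo the normalization, are admissible tests and
determine a locally integrable function. -/
theorem HasFourier.ae_eq {f : 𝓢'(R3, C3)} {g g' : R3 → C3} (hg : HasFourier f g)
    (hg' : HasFourier f g') : g =ᵐ[volume] g' := by
  refine ae_eq_of_integral_contDiff_smul_eq hg.1 hg'.1 fun ψ hψ hc => ?_
  have hpi : (2 * Real.pi) ≠ 0 := by positivity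
  have hsm : ContDiff ℝ ((⊤ : ℕ∞) : WithTop ℕ∞) fun η : R3 => ((ψ ((2 * Real.pi) • η) : ℝ) : ℂ) :=
    Complex.ofRealCLM.contDiff.comp (hψ.comp (contDiff_const_smul _))
  have hcs : HasCompactSupport fun η : R3 => ((ψ ((2 * Real.pi) • η) : ℝ) : ℂ) := by
    have h1 : HasCompactSupport fun η : R3 => ψ ((2 * Real.pi) • η) :=
      hc.comp_homeomorph (Homeomorph.smulOfNeZero _ hpi)
    exact h1.comp_left (g := fun x : ℝ => (x : ℂ)) (by simp)
  let θ : 𝓢(R3, ℂ) := hcs.toSchwartzMap hsm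
  have key : ∀ k : R3 → C3, ∫ η : R3, θ η • ((2 * Real.pi) ^ 3 • k ((2 * Real.pi) • η))
      = |((2 * Real.pi) ^ Module.finrank ℝ R3)⁻¹| • (2 * Real.pi) ^ 3 • ∫ ξ, ψ ξ • k ξ := by
    intro k
    rw [← integral_smul, ← Measure.integral_comp_smul volume
      (fun ξ => (2 * Real.pi) ^ 3 • ψ ξ • k ξ)]
    refine integral_congr_ae (Eventually.of_forall fun η => ?_)
    have : θ η = ((ψ ((2 * Real.pi) • η) : ℝ) : ℂ) := rfl
    simp only [this, Complex.coe_smul]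
    rw [smul_comm]
  have h1 := hg.2 θ hcs
  rw [hg'.2 θ hcs, key, key] at h1
  have h2 : |((2 * Real.pi) ^ Module.finrank ℝ R3)⁻¹| ≠ 0 := by positivity
  have h3 : (2 * Real.pi) ^ 3 ≠ 0 := by positivity
  exact (smul_right_injective _ h3 (smul_right_injective _ h2 h1)).symm

theorem HasFourier.fourierFun_ae_eq {f : 𝓢'(R3, C3)} {g : R3 → C3} (hg : HasFourier f g) :
    fourierFun f =ᵐ[volume] g := by
  have h : ∃ g, HasFourier f g := ⟨g, hg⟩
  rw [fourierFun, dif_pos h]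
  exact h.choose_spec.ae_eq hg

theorem HasFourier.integrable_smul {f : 𝓢'(R3, C3)} {g : R3 → C3} (hg : HasFourier f g)
    {θ : 𝓢(R3, ℂ)} (hθ : HasCompactSupport θ) :
    Integrable fun η : R3 => θ η • ((2 * Real.pi) ^ 3 • g ((2 * Real.pi) • η)) := by
  have hpi : (2 * Real.pi) ≠ 0 := by positivity
  have hc : HasCompactSupport fun ξ : R3 => θ ((2 * Real.pi)⁻¹ • ξ) :=
    hθ.comp_homeomorph (Homeomorph.smulOfNeZero _ (inv_ne_zero hpi))
  have hcont : Continuous fun ξ : R3 => θ ((2 * Real.pi)⁻¹ • ξ) :=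
    θ.continuous.comp (continuous_const_smul _)
  have h0 : Integrable fun ξ : R3 => θ ((2 * Real.pi)⁻¹ • ξ) • g ξ :=
    hg.1.integrable_smul_left_of_hasCompactSupport hcont hc
  have h1 := (Integrable.comp_smul h0 hpi).smul ((2 * Real.pi) ^ 3)
  refine h1.congr (Eventually.of_forall fun η => ?_)
  simp only [Pi.smul_apply, inv_smul_smul₀ hpi]
  rw [smul_comm]

theorem HasFourier.sub {f f' : 𝓢'(R3, C3)} {g g' : R3 → C3} (hg : HasFourier f g)
    (hg' : HasFourier f' g') : HasFourier (f - f') (fun ξ => g ξ - g' ξ) := by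
  refine ⟨hg.1.sub hg'.1, fun θ hθ => ?_⟩
  have h : (𝓕 (f - f')) θ = (𝓕 f) θ - (𝓕 f') θ := rfl
  rw [h, hg.2 θ hθ, hg'.2 θ hθ, ← integral_sub (hg.integrable_smul hθ) (hg'.integrable_smul hθ)]
  simp only [smul_sub]

/-! ### Bounds for the symbols -/

theorem enorm_le_sum (z : C3) : ‖z‖ₑ ≤ ∑ i, ‖z i‖ₑ := by
  have h : z = ∑ i, EuclideanSpace.single i (z i) := by
    ext j
    simp [Finset.sum_apply, Pi.single_apply]
  calc ‖z‖ₑ = ‖∑ i, EuclideanSpace.single i (z i)‖ₑ := by rw [← h]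
    _ ≤ ∑ i, ‖EuclideanSpace.single i (z i)‖ₑ := enorm_sum_le _ _
    _ = _ := by simp [← ofReal_norm]

theorem enorm_apply_le {𝕜 : Type*} [RCLike 𝕜] (z : EuclideanSpace 𝕜 (Fin 3)) (i : Fin 3) :
    ‖z i‖ₑ ≤ ‖z‖ₑ := by
  rw [← ofReal_norm, ← ofReal_norm]
  exact ENNReal.ofReal_le_ofReal (PiLp.norm_apply_le z i)

theorem act_apply (M : Matrix (Fin 3) (Fin 3) ℝ) (z : C3) (i : Fin 3) :
    act M z i = ∑ j, (M i j : ℂ) * z j := by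
  simp [act, Matrix.mulVec, dotProduct]

theorem act_sub (M : Matrix (Fin 3) (Fin 3) ℝ) (z w : C3) : act M (z - w) = act M z - act M w := by
  ext i
  simp [act_apply, mul_sub]

theorem enorm_act_le {M : Matrix (Fin 3) (Fin 3) ℝ} {m : ℝ} (hM : ∀ i j, |M i j| ≤ m) (z : C3) :
    ‖act M z‖ₑ ≤ 9 * (ENNReal.ofReal m * ‖z‖ₑ) := by
  refine (enorm_le_sum _).trans ?_
  have h : ∀ i, ‖act M z i‖ₑ ≤ 3 * (ENNReal.ofReal m * ‖z‖ₑ) := by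
    intro i
    rw [act_apply]
    refine (enorm_sum_le _ _).trans ?_
    calc ∑ j, ‖(M i j : ℂ) * z j‖ₑ ≤ ∑ _j : Fin 3, ENNReal.ofReal m * ‖z‖ₑ := by
          refine Finset.sum_le_sum fun j _ => ?_
          rw [enorm_mul]
          gcongr
          · rw [← ofReal_norm, Complex.norm_real]
            exact ENNReal.ofReal_le_ofReal (hM i j)
          · exact enorm_apply_le z j
      _ = _ := by simp
  calc ∑ i, ‖act M z i‖ₑ ≤ ∑ _i : Fin 3, 3 * (ENNReal.ofReal m * ‖z‖ₑ) :=
        Finset.sum_le_sum fun i _ => h i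
    _ = _ := by simp only [Finset.sum_const, Finset.card_univ, Fintype.card_fin, nsmul_eq_mul]
                rw [← mul_assoc]; norm_num

theorem abs_apply_div_norm_le (ξ : R3) (i : Fin 3) : |ξ i / ‖ξ‖| ≤ 1 := by
  rw [abs_div, abs_norm]
  exact div_le_one_of_le₀ (PiLp.norm_apply_le ξ i) (norm_nonneg _)

theorem abs_semigroupSymbol_le (ν α Ω t : ℝ) (ξ : R3) (i j : Fin 3) :
    |semigroupSymbol ν α Ω t ξ i j| ≤ 2 * Real.exp (-ν * t * ‖ξ‖ ^ (2 * α)) := by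
  have hR : |coriolisMatrix ξ i j| ≤ 1 := by
    fin_cases i <;> fin_cases j <;>
      simp [coriolisMatrix, abs_apply_div_norm_le, abs_neg]
  have h1 : |(1 : Matrix (Fin 3) (Fin 3) ℝ) i j| ≤ 1 := by
    rw [Matrix.one_apply]; split_ifs <;> simp
  simp only [semigroupSymbol, Matrix.smul_apply, Matrix.add_apply, smul_eq_mul]
  rw [abs_mul, Real.abs_exp, mul_comm]
  refine mul_le_mul_of_nonneg_right ?_ (Real.exp_pos _).le
  refine (abs_add_le _ _).trans ?_
  rw [abs_mul, abs_mul]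
  have h2 := mul_le_mul (Real.abs_cos_le_one (Ω * (ξ 2 / ‖ξ‖) * t)) h1 (abs_nonneg _) zero_le_one
  have h3 := mul_le_mul (Real.abs_sin_le_one (Ω * (ξ 2 / ‖ξ‖) * t)) hR (abs_nonneg _) zero_le_one
  linarith

theorem abs_leraySymbol_le (ξ : R3) (i j : Fin 3) : |leraySymbol ξ i j| ≤ 2 := by
  simp only [leraySymbol, Matrix.of_apply]
  refine (abs_sub _ _).trans ?_
  have h1 : |(if i = j then 1 else 0 : ℝ)| ≤ 1 := by split_ifs <;> simp
  have h2 : |ξ i * ξ j / ‖ξ‖ ^ 2| ≤ 1 := by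
    have : ξ i * ξ j / ‖ξ‖ ^ 2 = (ξ i / ‖ξ‖) * (ξ j / ‖ξ‖) := by rw [div_mul_div_comm, sq]
    rw [this, abs_mul]
    exact mul_le_one₀ (abs_apply_div_norm_le ξ i) (abs_nonneg _) (abs_apply_div_norm_le ξ j)
  linarith

theorem enorm_act_semigroup_le (ν α Ω t : ℝ) (ξ : R3) (z : C3) :
    ‖act (semigroupSymbol ν α Ω t ξ) z‖ₑ ≤
      18 * (ENNReal.ofReal (Real.exp (-ν * t * ‖ξ‖ ^ (2 * α))) * ‖z‖ₑ) := by
  refine (enorm_act_le (abs_semigroupSymbol_le ν α Ω t ξ) z).trans (le_of_eq ?_)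
  rw [ENNReal.ofReal_mul two_pos.le, ENNReal.ofReal_ofNat, mul_assoc, ← mul_assoc]
  norm_num

theorem enorm_act_leray_le (ξ : R3) (z : C3) : ‖act (leraySymbol ξ) z‖ₑ ≤ 18 * ‖z‖ₑ := by
  refine (enorm_act_le (abs_leraySymbol_le ξ) z).trans (le_of_eq ?_)
  rw [ENNReal.ofReal_ofNat, ← mul_assoc]
  norm_num

theorem enorm_act_semigroup_leray_le (ν α Ω t : ℝ) (ξ : R3) (z : C3) :
    ‖act (semigroupSymbol ν α Ω t ξ) (act (leraySymbol ξ) z)‖ₑ ≤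
      324 * (ENNReal.ofReal (Real.exp (-ν * t * ‖ξ‖ ^ (2 * α))) * ‖z‖ₑ) := by
  refine (enorm_act_semigroup_le ν α Ω t ξ _).trans ?_
  calc _ ≤ 18 * (ENNReal.ofReal (Real.exp (-ν * t * ‖ξ‖ ^ (2 * α))) * (18 * ‖z‖ₑ)) := by
        gcongr; exact enorm_act_leray_le ξ z
    _ = (18 * 18) * (ENNReal.ofReal (Real.exp (-ν * t * ‖ξ‖ ^ (2 * α))) * ‖z‖ₑ) := by ring
    _ = _ := by norm_num

theorem enorm_div_le (ξ : R3) {T : Fin 3 → Fin 3 → ℂ} {c : ℝ≥0∞} (hT : ∀ m k, ‖T m k‖ₑ ≤ c) :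
    ‖(WithLp.toLp 2 fun k => ∑ m : Fin 3, Complex.I * (ξ m : ℂ) * T m k : C3)‖ₑ
      ≤ 9 * (‖ξ‖ₑ * c) := by
  refine (enorm_le_sum _).trans ?_
  have h : ∀ k m, ‖Complex.I * (ξ m : ℂ) * T m k‖ₑ ≤ ‖ξ‖ₑ * c := by
    intro k m
    rw [enorm_mul, enorm_mul]
    have h1 : ‖Complex.I‖ₑ = 1 := by rw [← ofReal_norm]; simp
    have h2 : ‖(ξ m : ℂ)‖ₑ ≤ ‖ξ‖ₑ := by
      rw [← ofReal_norm, Complex.norm_real, ofReal_norm]; exact enorm_apply_le ξ m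
    rw [h1, one_mul]
    gcongr
    exact hT m k
  calc _ ≤ ∑ _k : Fin 3, ∑ _m : Fin 3, ‖ξ‖ₑ * c := Finset.sum_le_sum fun k _ =>
        (enorm_sum_le _ _).trans (Finset.sum_le_sum fun m _ => h k m)
    _ = _ := by
        simp only [Finset.sum_const, Finset.card_univ, Fintype.card_fin, nsmul_eq_mul]
        rw [← mul_assoc]; norm_num

theorem enorm_tensorHat_le (V W : R3 → C3) (ξ : R3) (m k : Fin 3) :
    ‖tensorHat V W ξ m k‖ₑ ≤ conv (fun η => ‖V η‖ₑ) (fun η => ‖W η‖ₑ) ξ := by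
  refine (enorm_integral_le_lintegral_enorm _).trans (lintegral_mono fun η => ?_)
  rw [enorm_mul]
  exact mul_le_mul' (enorm_apply_le _ _) (enorm_apply_le _ _)

theorem enorm_divTensorHat_le (V W : R3 → C3) (ξ : R3) :
    ‖divTensorHat V W ξ‖ₑ ≤ 9 * (‖ξ‖ₑ * conv (fun η => ‖V η‖ₑ) (fun η => ‖W η‖ₑ) ξ) :=
  enorm_div_le ξ fun m k => enorm_tensorHat_le V W ξ m k

theorem integrable_tensor {V W : R3 → C3} (hV : AEMeasurable V) (hW : AEMeasurable W) {ξ : R3}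
    (h : conv (fun η => ‖V η‖ₑ) (fun η => ‖W η‖ₑ) ξ ≠ ∞) (m k : Fin 3) :
    Integrable fun η => V (ξ - η) m * W η k := by
  have happ : ∀ i : Fin 3, Measurable fun z : C3 => z i := fun i => by fun_prop
  have hV' : AEMeasurable fun η => V (ξ - η) :=
    hV.comp_quasiMeasurePreserving
      (Measure.measurePreserving_sub_left volume ξ).quasiMeasurePreserving
  refine ⟨(((happ m).comp_aemeasurable hV').mul
    ((happ k).comp_aemeasurable hW)).aestronglyMeasurable, ?_⟩
  refine lt_of_le_of_lt (lintegral_mono fun η => ?_) (lt_top_iff_ne_top.2 h)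
  rw [enorm_mul]
  exact mul_le_mul' (enorm_apply_le _ _) (enorm_apply_le _ _)

/-- Rests on $U\otimes U-V\otimes V=U\otimes(U-V)+(U-V)\otimes V$. Finite convolutions of the norms
make both integrals genuine; a divergent one would be $0$ by convention and could not be subtracted.
-/
theorem enorm_divTensorHat_sub_le {U V : R3 → C3} (hU : AEMeasurable U) (hV : AEMeasurable V)
    {ξ : R3} (h1 : conv (fun η => ‖U η‖ₑ) (fun η => ‖U η‖ₑ) ξ ≠ ∞)
    (h2 : conv (fun η => ‖V η‖ₑ) (fun η => ‖V η‖ₑ) ξ ≠ ∞) :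
    ‖divTensorHat U U ξ - divTensorHat V V ξ‖ₑ ≤
      9 * (‖ξ‖ₑ * (conv (fun η => ‖U η‖ₑ) (fun η => ‖U η - V η‖ₑ) ξ +
        conv (fun η => ‖U η - V η‖ₑ) (fun η => ‖V η‖ₑ) ξ)) := by
  have e : divTensorHat U U ξ - divTensorHat V V ξ = (WithLp.toLp 2 fun k => ∑ m : Fin 3,
      Complex.I * (ξ m : ℂ) * (tensorHat U U ξ m k - tensorHat V V ξ m k) : C3) := by
    ext k
    simp [divTensorHat, mul_sub]
  rw [e]
  refine enorm_div_le ξ fun m k => ?_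
  rw [tensorHat, tensorHat, ← integral_sub (integrable_tensor hU hU h1 m k)
    (integrable_tensor hV hV h2 m k)]
  refine (enorm_integral_le_lintegral_enorm _).trans ?_
  have hm : AEMeasurable fun η => ‖U (ξ - η)‖ₑ * ‖U η - V η‖ₑ :=
    (hU.comp_quasiMeasurePreserving
      (Measure.measurePreserving_sub_left volume ξ).quasiMeasurePreserving).enorm.mul
      (hU.sub hV).enorm
  rw [conv, conv, ← lintegral_add_left' hm]
  refine lintegral_mono fun η => ?_
  have : U (ξ - η) m * U η k - V (ξ - η) m * V η k
      = U (ξ - η) m * (U η - V η) k + (U (ξ - η) - V (ξ - η)) m * V η k := by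
    simp only [PiLp.sub_apply]; ring
  rw [this]
  refine (enorm_add_le _ _).trans ?_
  rw [enorm_mul, enorm_mul]
  exact add_le_add (mul_le_mul' (enorm_apply_le _ _) (enorm_apply_le _ _))
    (mul_le_mul' (enorm_apply_le _ _) (enorm_apply_le _ _))

/-! ### Measurability and linearity of the Duhamel integrals -/

theorem ae_prod_le_of_ae_ae {α β : Type*} [MeasurableSpace α] [MeasurableSpace β]
    {μ : Measure α} {ν : Measure β} [SFinite ν] {f g : α → β → ℝ≥0∞}
    (hf : AEMeasurable (Function.uncurry f) (μ.prod ν))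
    (hg : AEMeasurable (Function.uncurry g) (μ.prod ν))
    (h : ∀ᵐ y ∂μ, ∀ᵐ x ∂ν, f y x ≤ g y x) :
    ∀ᵐ z ∂(μ.prod ν), f z.1 z.2 ≤ g z.1 z.2 := by
  obtain ⟨F, hF, hFe⟩ := hf
  obtain ⟨G, hG, hGe⟩ := hg
  have : ∀ᵐ z ∂(μ.prod ν), F z ≤ G z := by
    refine (Measure.ae_prod_iff_ae_ae (measurableSet_le hF hG)).2 ?_
    filter_upwards [h, Measure.ae_ae_of_ae_prod hFe, Measure.ae_ae_of_ae_prod hGe] with y h1 h2 h3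
    filter_upwards [h1, h2, h3] with x h1 h2 h3
    rw [← h2, ← h3]; exact h1
  filter_upwards [this, hFe, hGe] with z h1 h2 h3
  change Function.uncurry f z ≤ Function.uncurry g z
  rw [h2, h3]; exact h1

/-- The hypothesis has null sets in $\xi$ for fixed $\tau$, whereas the integral freezes $\xi$ and
runs over $\tau$; Fubini exchanges the two. -/
theorem duhamel_mono_ae {ν α t : ℝ} {f g : ℝ → R3 → ℝ≥0∞}
    (hf : AEMeasurable (Function.uncurry f) (posTime.prod volume))
    (hg : AEMeasurable (Function.uncurry g) (posTime.prod volume))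
    (h : ∀ᵐ τ ∂posTime, ∀ᵐ ξ : R3, f τ ξ ≤ g τ ξ) :
    ∀ᵐ ξ : R3, duhamel ν α f t ξ ≤ duhamel ν α g t ξ := by
  have h1 : ∀ᵐ z ∂((volume : Measure R3).prod posTime), f z.2 z.1 ≤ g z.2 z.1 :=
    Measure.measurePreserving_swap.quasiMeasurePreserving.ae (ae_prod_le_of_ae_ae hf hg h)
  filter_upwards [Measure.ae_ae_of_ae_prod h1] with ξ hξ
  refine lintegral_mono_ae ?_
  filter_upwards [ae_restrict_Ioc_of_posTime hξ] with τ hτ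
  gcongr

theorem duhamel_add_ae {ν α t : ℝ} (hα : 0 < α) {f : ℝ → R3 → ℝ≥0∞} (g : ℝ → R3 → ℝ≥0∞)
    (hf : AEMeasurable (Function.uncurry f) (posTime.prod volume)) :
    ∀ᵐ ξ : R3, duhamel ν α (fun τ ξ => f τ ξ + g τ ξ) t ξ
      = duhamel ν α f t ξ + duhamel ν α g t ξ := by
  have h := ae_aemeasurable_section_right (g := fun τ ξ =>
      ENNReal.ofReal (Real.exp (-ν * (t - τ) * ‖ξ‖ ^ (2 * α))) * f τ ξ)
    ((measurable_heatKernel hα ν t).aemeasurable.mul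
      (hf.mono_ac (restrict_Ioc_prod_absolutelyContinuous t)))
  filter_upwards [h] with ξ hξ
  rw [duhamel, duhamel, duhamel, ← lintegral_add_left' hξ]
  simp only [mul_add]

theorem duhamel_const_mul {ν α t : ℝ} {c : ℝ≥0∞} (hc : c ≠ ∞) (f : ℝ → R3 → ℝ≥0∞) (ξ : R3) :
    duhamel ν α (fun τ ξ => c * f τ ξ) t ξ = c * duhamel ν α f t ξ := by
  rw [duhamel, duhamel, ← lintegral_const_mul' _ _ hc]
  simp only [mul_left_comm]

theorem aemeasurable_C3_iff {X : Type*} [MeasurableSpace X] {μ : Measure X} {f : X → C3} :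
    AEMeasurable f μ ↔ ∀ i, AEMeasurable (fun x => f x i) μ := by
  constructor
  · intro h i
    have happ : Measurable fun z : C3 => z i := by fun_prop
    exact happ.comp_aemeasurable h
  · intro h
    have : AEMeasurable (fun x => (f x).ofLp) μ := aemeasurable_pi_iff.2 h
    have h2 := (WithLp.measurable_toLp 2 (Fin 3 → ℂ)).comp_aemeasurable this
    exact h2

theorem aemeasurable_act {X : Type*} [MeasurableSpace X] {μ : Measure X}
    {M : X → Matrix (Fin 3) (Fin 3) ℝ} (hM : ∀ i j, Measurable fun x => M x i j) {f : X → C3}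
    (hf : AEMeasurable f μ) : AEMeasurable (fun x => act (M x) (f x)) μ := by
  rw [aemeasurable_C3_iff] at hf ⊢
  intro i
  simp only [act_apply]
  refine Finset.aemeasurable_fun_sum _ fun j _ => ?_
  exact (Complex.measurable_ofReal.comp (hM i j)).aemeasurable.mul (hf j)

theorem measurable_leraySymbol (i j : Fin 3) : Measurable fun ξ : R3 => leraySymbol ξ i j := by
  simp only [leraySymbol, Matrix.of_apply]
  fun_prop

theorem measurable_coriolisMatrix (i j : Fin 3) :
    Measurable fun ξ : R3 => coriolisMatrix ξ i j := by
  fin_cases i <;> fin_cases j <;> simp [coriolisMatrix] <;> fun_prop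

theorem measurable_semigroupSymbol {α : ℝ} (ν Ω : ℝ) (i j : Fin 3) :
    Measurable fun z : ℝ × R3 => semigroupSymbol ν α Ω z.1 z.2 i j := by
  have h1 : Measurable fun z : ℝ × R3 => coriolisMatrix z.2 i j :=
    (measurable_coriolisMatrix i j).comp measurable_snd
  simp only [semigroupSymbol, Matrix.smul_apply, Matrix.add_apply, smul_eq_mul]
  fun_prop

theorem aemeasurable_semigroup_leray {α : ℝ} (ν Ω t : ℝ) {Z : ℝ → R3 → C3} {μ : Measure (ℝ × R3)}
    (hZ : AEMeasurable (Function.uncurry Z) μ) :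
    AEMeasurable (Function.uncurry fun τ ξ =>
      act (semigroupSymbol ν α Ω (t - τ) ξ) (act (leraySymbol ξ) (Z τ ξ))) μ := by
  have hs : Measurable fun z : ℝ × R3 => (t - z.1, z.2) := by fun_prop
  exact aemeasurable_act
    (M := fun z : ℝ × R3 => semigroupSymbol ν α Ω (t - z.1) z.2)
    (fun i j => (measurable_semigroupSymbol ν Ω i j).comp hs)
    (aemeasurable_act (M := fun z : ℝ × R3 => leraySymbol z.2)
      (fun i j => (measurable_leraySymbol i j).comp measurable_snd) hZ)

theorem aemeasurable_divTensorHat {V W : ℝ → R3 → C3}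
    (hV : AEMeasurable (Function.uncurry V) (posTime.prod volume))
    (hW : AEMeasurable (Function.uncurry W) (posTime.prod volume)) :
    AEMeasurable (Function.uncurry fun τ ξ => divTensorHat (V τ) (W τ) ξ)
      (posTime.prod volume) := by
  have key : ∀ m k, AEMeasurable (fun z : ℝ × R3 => tensorHat (V z.1) (W z.1) z.2 m k)
      (posTime.prod volume) := by
    intro m k
    have happ : ∀ i : Fin 3, Measurable fun z : C3 => z i := fun i => by fun_prop
    obtain ⟨F, hF, hFe⟩ := hV
    obtain ⟨G, hG, hGe⟩ := hW
    refine ⟨fun z => ∫ η : R3, F (z.1, z.2 - η) m * G (z.1, η) k, ?_, ?_⟩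
    · have : Measurable (Function.uncurry fun (z : ℝ × R3) (η : R3) =>
          F (z.1, z.2 - η) m * G (z.1, η) k) := by
        refine ((happ m).comp (hF.comp ?_)).mul ((happ k).comp (hG.comp ?_))
        · fun_prop
        · fun_prop
      exact this.stronglyMeasurable.integral_prod_right'.measurable
    · have h : ∀ᵐ τ ∂posTime, ∀ ξ, tensorHat (V τ) (W τ) ξ m k
          = ∫ η : R3, F (τ, ξ - η) m * G (τ, η) k := by
        filter_upwards [Measure.ae_ae_of_ae_prod hFe, Measure.ae_ae_of_ae_prod hGe] with τ h1 h2 ξ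
        refine integral_congr_ae ?_
        have h3 : ∀ᵐ η : R3, V τ (ξ - η) = F (τ, ξ - η) :=
          (Measure.measurePreserving_sub_left volume ξ).quasiMeasurePreserving.ae h1
        filter_upwards [h2, h3] with η h2 h3
        change V τ (ξ - η) m * W τ η k = _
        change W τ η = _ at h2
        rw [h2, h3]
      filter_upwards [Measure.quasiMeasurePreserving_fst.ae h] with z hz using hz z.2
  rw [aemeasurable_C3_iff]
  intro k
  simp only [Function.uncurry_def, divTensorHat]
  refine Finset.aemeasurable_fun_sum _ fun m _ => ?_
  have : Measurable fun z : ℝ × R3 => Complex.I * (z.2 m : ℂ) :=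
    (Complex.measurable_ofReal.comp (by fun_prop)).const_mul _
  exact this.aemeasurable.mul (key m k)

theorem enorm_forceHat_le {ν α Ω t : ℝ} (ht : 0 ≤ t) (Z : ℝ → R3 → C3) (ξ : R3) :
    ‖forceHat ν α Ω Z t ξ‖ₑ ≤ 324 * duhamel ν α (fun τ ξ => ‖Z τ ξ‖ₑ) t ξ := by
  rw [forceHat, intervalIntegral.integral_of_le ht, duhamel, ← lintegral_const_mul' _ _ (by simp)]
  exact (enorm_integral_le_lintegral_enorm _).trans
    (lintegral_mono fun τ => enorm_act_semigroup_leray_le ν α Ω (t - τ) ξ _)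

/-- Finite Duhamel integrals of the norms give integrability in $\tau$ for almost every $\xi$, hence
linearity. -/
theorem enorm_forceHat_sub_le {ν α Ω t : ℝ} (ht : 0 ≤ t) {Z Z' : ℝ → R3 → C3}
    (hZ : AEMeasurable (Function.uncurry Z) (posTime.prod volume))
    (hZ' : AEMeasurable (Function.uncurry Z') (posTime.prod volume))
    (h : ∀ᵐ ξ : R3, duhamel ν α (fun τ ξ => ‖Z τ ξ‖ₑ) t ξ < ∞)
    (h' : ∀ᵐ ξ : R3, duhamel ν α (fun τ ξ => ‖Z' τ ξ‖ₑ) t ξ < ∞) :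
    ∀ᵐ ξ : R3, ‖forceHat ν α Ω Z t ξ - forceHat ν α Ω Z' t ξ‖ₑ
      ≤ 324 * duhamel ν α (fun τ ξ => ‖Z τ ξ - Z' τ ξ‖ₑ) t ξ := by
  have hm : ∀ {Z : ℝ → R3 → C3}, AEMeasurable (Function.uncurry Z) (posTime.prod volume) →
      ∀ᵐ ξ : R3, AEMeasurable (fun τ =>
        act (semigroupSymbol ν α Ω (t - τ) ξ) (act (leraySymbol ξ) (Z τ ξ)))
        (volume.restrict (Ioc 0 t)) := fun hZ =>
    ae_aemeasurable_section_right (aemeasurable_semigroup_leray ν Ω t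
      (hZ.mono_ac (restrict_Ioc_prod_absolutelyContinuous t)))
  have hi : ∀ {Z : ℝ → R3 → C3} {ξ : R3}, AEMeasurable (fun τ =>
        act (semigroupSymbol ν α Ω (t - τ) ξ) (act (leraySymbol ξ) (Z τ ξ)))
        (volume.restrict (Ioc 0 t)) → duhamel ν α (fun τ ξ => ‖Z τ ξ‖ₑ) t ξ < ∞ →
      IntegrableOn (fun τ => act (semigroupSymbol ν α Ω (t - τ) ξ) (act (leraySymbol ξ) (Z τ ξ)))
        (Ioc 0 t) := by
    intro Z ξ hm hd
    refine ⟨hm.aestronglyMeasurable, lt_of_le_of_lt (lintegral_mono fun τ =>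
      enorm_act_semigroup_leray_le ν α Ω (t - τ) ξ _) ?_⟩
    rw [lintegral_const_mul' _ _ (by simp)]
    exact ENNReal.mul_lt_top (by simp) hd
  filter_upwards [h, h', hm hZ, hm hZ'] with ξ h h' hm hm'
  rw [forceHat, forceHat, intervalIntegral.integral_of_le ht, intervalIntegral.integral_of_le ht,
    ← integral_sub (hi hm h) (hi hm' h'), duhamel, ← lintegral_const_mul' _ _ (by simp)]
  refine (enorm_integral_le_lintegral_enorm _).trans (lintegral_mono fun τ => ?_)
  rw [← act_sub, ← act_sub]
  exact enorm_act_semigroup_leray_le ν α Ω (t - τ) ξ _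

theorem bilinHat_eq_neg_forceHat (ν α Ω : ℝ) (V W : ℝ → R3 → C3) (t : ℝ) (ξ : R3) :
    bilinHat ν α Ω V W t ξ
      = -forceHat ν α Ω (fun τ ξ => divTensorHat (V τ) (W τ) ξ) t ξ := rfl

theorem enorm_bilinHat_le {ν α Ω t : ℝ} (ht : 0 ≤ t) (V W : ℝ → R3 → C3) (ξ : R3) :
    ‖bilinHat ν α Ω V W t ξ‖ₑ ≤ 2916 * duhamel ν α (fun τ ξ => ‖ξ‖ₑ *
      conv (fun η => ‖V τ η‖ₑ) (fun η => ‖W τ η‖ₑ) ξ) t ξ := by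
  rw [bilinHat_eq_neg_forceHat, enorm_neg]
  refine (enorm_forceHat_le ht _ ξ).trans ?_
  have h9 : (2916 : ℝ≥0∞) = 324 * 9 := by norm_num
  rw [h9, mul_assoc, ← duhamel_const_mul (c := 9) (by simp)]
  exact mul_le_mul' le_rfl (lintegral_mono fun τ =>
    mul_le_mul' le_rfl (enorm_divTensorHat_le _ _ ξ))

/-! ### Decay of the tails -/

/-- The $\ell^q$ norm at each time dominates every weighted block, so the block tails become small
uniformly in $j$. This settles $q=\infty$. For $q<\infty$ the supremum in time lies inside the sum,
and dominated convergence applies, with the tails from time $0$ as majorant. -/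
theorem tendsto_tailNorm_zero {φ : 𝓢(R3, ℝ)} {s : ℝ} {p q : ℝ≥0∞} (hq : 1 ≤ q)
    {g : ℝ → R3 → ℝ≥0∞} (hfin : tailNorm φ s p q 0 g ≠ ∞)
    (h : Tendsto (fun t => seqNorm s q fun j => blk φ p j (g t)) atTop (𝓝 0)) :
    Tendsto (fun T => tailNorm φ s p q T g) atTop (𝓝 0) := by
  have key : ∀ δ > (0 : ℝ≥0∞), ∀ᶠ T in atTop, ∀ j : ℤ, pow2 (j * s) * tail φ p T g j ≤ δ := by
    intro δ hδ
    obtain ⟨T₀, hT₀⟩ := eventually_atTop.1 (ENNReal.tendsto_nhds_zero.1 h δ hδ)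
    filter_upwards [eventually_ge_atTop T₀] with T hT j
    have : tail φ p T g j ≤ pow2 (-(j * s)) * δ := by
      refine tail_le_of_ae ?_
      filter_upwards [ae_restrict_mem measurableSet_Ioi] with t ht
      have h1 := (le_seqNorm hq (s := s) (fun j => blk φ p j (g t)) j).trans
        (hT₀ t (hT.trans (le_of_lt ht)))
      calc blk φ p j (g t) = pow2 (-(j * s)) * (pow2 (j * s) * blk φ p j (g t)) := by
            rw [← mul_assoc, pow2_neg_mul_pow2, one_mul]
        _ ≤ _ := by gcongr
    calc _ ≤ pow2 (j * s) * (pow2 (-(j * s)) * δ) := by gcongr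
      _ = δ := by rw [← mul_assoc, pow2_mul_pow2_neg, one_mul]
  rcases eq_or_ne q ∞ with rfl | hqt
  · rw [ENNReal.tendsto_nhds_zero]
    intro δ hδ
    filter_upwards [key δ hδ] with T hT
    rw [tailNorm, seqNorm_eq, eLpNorm_ennreal_top]
    exact essSup_le_of_ae_le _ (Eventually.of_forall hT)
  · have hq0 : q ≠ 0 := (zero_lt_one.trans_le hq).ne'
    have hr : 0 < q.toReal := ENNReal.toReal_pos hq0 hqt
    simp only [tailNorm, seqNorm_eq, eLpNorm_ennreal_eq hq0 hqt] at hfin ⊢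
    have hfin' : ∫⁻ j : ℤ, (pow2 (j * s) * tail φ p 0 g j) ^ q.toReal ∂Measure.count ≠ ∞ := by
      intro hcon
      rw [hcon, ENNReal.top_rpow_of_pos (by positivity)] at hfin
      exact hfin rfl
    have hlim := tendsto_lintegral_filter_of_dominated_convergence (μ := Measure.count)
      (l := (atTop : Filter ℝ))
      (F := fun (T : ℝ) (j : ℤ) => (pow2 (j * s) * tail φ p T g j) ^ q.toReal)
      (f := fun _ => 0) (fun j : ℤ => (pow2 (j * s) * tail φ p 0 g j) ^ q.toReal)
      (Eventually.of_forall fun _ => by fun_prop)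
      (by
        filter_upwards [eventually_ge_atTop 0] with T hT
        refine Eventually.of_forall fun j => ?_
        gcongr
        exact tail_anti φ p hT g j) hfin'
      (Eventually.of_forall fun j => by
        have h1 : Tendsto (fun T => pow2 (j * s) * tail φ p T g j) atTop (𝓝 0) :=
          ENNReal.tendsto_nhds_zero.2 fun δ hδ => (key δ hδ).mono fun T hT => hT j
        have h2 := (ENNReal.continuous_rpow_const (y := q.toReal)).tendsto 0 |>.comp h1
        simpa [Function.comp_def, ENNReal.zero_rpow_of_pos hr] using h2)
    have h2 := (ENNReal.continuous_rpow_const (y := 1 / q.toReal)).tendsto _ |>.comp hlim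
    simpa [Function.comp_def, hr] using h2

theorem tendsto_div_sub_atTop (T : ℝ) :
    Tendsto (fun t => ENNReal.ofReal (T / (t - T))) atTop (𝓝 0) := by
  have : Tendsto (fun t : ℝ => T / (t - T)) atTop (𝓝 0) :=
    tendsto_const_nhds.div_atTop (tendsto_atTop_add_const_right _ (-T) tendsto_id)
  simpa using ENNReal.tendsto_ofReal this

/-- First fix $T$ so that $B(T)$ is small, then let $t\to\infty$ to remove the memory term. -/
theorem tendsto_zero_of_le_tail {N E B : ℝ → ℝ≥0∞} {M : ℝ≥0∞} (hM : M ≠ ∞)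
    (hE : Tendsto E atTop (𝓝 0)) (hB : Tendsto B atTop (𝓝 0))
    (h : ∀ T ≥ 0, ∀ t > T, N t ≤ E t + (B T + ENNReal.ofReal (T / (t - T)) * M)) :
    Tendsto N atTop (𝓝 0) := by
  rw [ENNReal.tendsto_nhds_zero]
  intro δ hδ
  have hδ2 : 0 < δ / 2 := ENNReal.half_pos hδ.ne'
  obtain ⟨T, hT, hT0⟩ := ((ENNReal.tendsto_nhds_zero.1 hB _ hδ2).and
    (eventually_ge_atTop 0)).exists
  have hlim : Tendsto (fun t => E t + ENNReal.ofReal (T / (t - T)) * M) atTop (𝓝 (0 + 0 * M)) :=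
    hE.add (ENNReal.Tendsto.mul_const (tendsto_div_sub_atTop T) (Or.inr hM))
  rw [zero_mul, add_zero] at hlim
  filter_upwards [ENNReal.tendsto_nhds_zero.1 hlim _ hδ2, eventually_gt_atTop T] with t h1 h2
  calc N t ≤ E t + (B T + ENNReal.ofReal (T / (t - T)) * M) := h T hT0 t h2
    _ = (E t + ENNReal.ofReal (T / (t - T)) * M) + B T := by ring
    _ ≤ δ / 2 + δ / 2 := add_le_add h1 hT
    _ = δ := ENNReal.add_halves δ

/-- A nonnegative function that is bounded in the limit by a fixed fraction of its own tails tends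
to zero with them. -/
theorem tendsto_zero_of_tail_contraction {D E Y : ℝ → ℝ≥0∞} {k c M : ℝ≥0∞} (hD : Antitone D)
    (hD0 : D 0 ≠ ∞) (hk : k < 1) (hc : c ≠ ∞) (hM : M ≠ ∞) (hE : Tendsto E atTop (𝓝 0))
    (hY : Tendsto Y atTop (𝓝 0))
    (h : ∀ T ≥ 0, ∀ t > T, D t ≤ E t + (k * D T + ENNReal.ofReal (T / (t - T)) * M + c * Y T)) :
    Tendsto D atTop (𝓝 0) := by
  have hL := tendsto_atTop_iInf hD
  set L := ⨅ T, D T with hLdef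
  have hLD : ∀ T, L ≤ D T := fun T => iInf_le _ T
  have hLt : L ≠ ∞ := ne_top_of_le_ne_top hD0 (hLD 0)
  -- Here $t\to\infty$ with $T$ fixed: the linear and memory terms disappear.
  have h1 : ∀ T ≥ 0, L ≤ k * D T + c * Y T := by
    intro T hT
    have hlim : Tendsto (fun t => E t + (k * D T + ENNReal.ofReal (T / (t - T)) * M + c * Y T))
        atTop (𝓝 (0 + (k * D T + 0 * M + c * Y T))) :=
      hE.add ((tendsto_const_nhds.add
        (ENNReal.Tendsto.mul_const (tendsto_div_sub_atTop T) (Or.inr hM))).add tendsto_const_nhds)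
    rw [zero_mul, zero_add, add_zero] at hlim
    refine ge_of_tendsto hlim ?_
    filter_upwards [eventually_gt_atTop T] with t ht using (hLD t).trans (h T hT t ht)
  -- Now $T\to\infty$, so that $D(T)\to L$ on the right as well.
  have h2 : L ≤ k * L + c * 0 := by
    refine ge_of_tendsto ((ENNReal.Tendsto.const_mul hL (Or.inr hk.ne_top)).add
      (ENNReal.Tendsto.const_mul hY (Or.inr hc))) ?_
    filter_upwards [eventually_ge_atTop 0] with T hT using h1 T hT
  rw [mul_zero, add_zero] at h2
  have h3 : L = 0 := by
    by_contra h0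
    have : k * L < 1 * L := ENNReal.mul_lt_mul_left h0 hLt hk
    rw [one_mul] at this
    exact absurd h2 (not_le.2 this)
  rwa [h3] at hL

/-! ### Norms of distributions and of their transforms -/

theorem fbNormHat_eq (φ : 𝓢(R3, ℝ)) (s : ℝ) (p q : ℝ≥0∞) (g : R3 → C3) :
    fbNormHat φ s p q g = seqNorm s q fun j => blk φ p j fun ξ => ‖g ξ‖ₑ := by
  simp only [fbNormHat, block_eq_blk]

theorem HasFourier.fbNorm_eq {f : 𝓢'(R3, C3)} {g : R3 → C3} (hg : HasFourier f g)
    (φ : 𝓢(R3, ℝ)) (s : ℝ) (p q : ℝ≥0∞) :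
    fbNorm φ s p q f = seqNorm s q fun j => blk φ p j fun ξ => ‖g ξ‖ₑ := by
  rw [fbNorm, fbNormHat_eq]
  congr 1
  funext j
  exact blk_congr_ae (hg.fourierFun_ae_eq.mono fun ξ h => by simp only [h])

theorem pathNormHat_eq (φ : 𝓢(R3, ℝ)) (s : ℝ) (p q : ℝ≥0∞) (U : ℝ → R3 → C3) :
    pathNormHat φ s p q U = tailNorm φ s p q 0 fun t ξ => ‖U t ξ‖ₑ := by
  simp only [pathNormHat, block_eq_blk]
  rfl

theorem HasFourierPath.pathNorm_eq {f : ℝ → 𝓢'(R3, C3)} {U : ℝ → R3 → C3}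
    (hU : HasFourierPath f U) (φ : 𝓢(R3, ℝ)) (s : ℝ) (p q : ℝ≥0∞) :
    pathNorm φ s p q f = tailNorm φ s p q 0 fun t ξ => ‖U t ξ‖ₑ := by
  rw [pathNorm, pathNormHat_eq, tailNorm, tailNorm]
  congr 1
  funext j
  exact tail_congr_ae fun t ht => (hU.2 t ht).fourierFun_ae_eq.mono fun ξ h => by
    simp only [h]

theorem aemeasurable_uncurry_enorm {U : ℝ → R3 → C3} {μ : Measure (ℝ × R3)}
    (hU : AEMeasurable (Function.uncurry U) μ) :
    AEMeasurable (Function.uncurry fun t ξ => ‖U t ξ‖ₑ) μ :=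
  hU.enorm

theorem HasFourierPath.aemeasurable {f : ℝ → 𝓢'(R3, C3)} {U : ℝ → R3 → C3}
    (hU : HasFourierPath f U) : AEMeasurable (Function.uncurry U) (posTime.prod volume) :=
  hU.1.aemeasurable

theorem HasFourier.aemeasurable {f : 𝓢'(R3, C3)} {g : R3 → C3} (hg : HasFourier f g) :
    AEMeasurable g :=
  hg.1.aestronglyMeasurable.aemeasurable

theorem ne_top_of_seqNorm_ne_top {s : ℝ} {q : ℝ≥0∞} (hq : 1 ≤ q) {c : ℤ → ℝ≥0∞}
    (h : seqNorm s q c ≠ ∞) (j : ℤ) : c j ≠ ∞ := by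
  intro hc
  have := le_seqNorm (s := s) hq c j
  rw [hc, ENNReal.mul_top (pow2_ne_zero _), top_le_iff] at this
  exact h this

/-! ### The linear evolution and the difference of two mild solutions. -/

theorem semigroupHat_sub_ae (ν α Ω t : ℝ) {f f' : 𝓢'(R3, C3)} {g g' : R3 → C3}
    (hg : HasFourier f g) (hg' : HasFourier f' g') :
    ∀ᵐ ξ : R3, semigroupHat ν α Ω t f ξ - semigroupHat ν α Ω t f' ξ
      = semigroupHat ν α Ω t (f - f') ξ := by
  filter_upwards [hg.fourierFun_ae_eq, hg'.fourierFun_ae_eq, (hg.sub hg').fourierFun_ae_eq]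
    with ξ h1 h2 h3
  simp only [semigroupHat, h1, h2, h3, act_sub]

theorem aemeasurable_semigroupHat (ν α Ω t : ℝ) {f : 𝓢'(R3, C3)} {g : R3 → C3}
    (hg : HasFourier f g) : AEMeasurable (semigroupHat ν α Ω t f) := by
  have hs : Measurable fun ξ : R3 => (t, ξ) := by fun_prop
  exact aemeasurable_act (M := fun ξ => semigroupSymbol ν α Ω t ξ)
    (fun i j => (measurable_semigroupSymbol ν Ω i j).comp hs)
    (hg.aemeasurable.congr hg.fourierFun_ae_eq.symm)

theorem tailNorm_semigroupHat_le {φ : 𝓢(R3, ℝ)} {s : ℝ} {p q : ℝ≥0∞} (hp : 1 ≤ p) (hq : 1 ≤ q)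
    {ν : ℝ} (hν : 0 < ν) (α Ω : ℝ) {f : 𝓢'(R3, C3)} {g : R3 → C3} (hg : HasFourier f g) :
    tailNorm φ s p q 0 (fun t ξ => ‖semigroupHat ν α Ω t f ξ‖ₑ) ≤ 18 * fbNorm φ s p q f := by
  rw [hg.fbNorm_eq, ← seqNorm_const_mul hq]
  refine seqNorm_mono fun j => tail_le_of_ae ?_
  filter_upwards [ae_restrict_mem measurableSet_Ioi] with t ht
  rw [← blk_const_mul hp hg.aemeasurable.enorm]
  refine blk_mono_ae ?_
  filter_upwards [hg.fourierFun_ae_eq] with ξ hξ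
  refine (enorm_act_semigroup_le ν α Ω t ξ _).trans ?_
  rw [hξ]
  refine mul_le_mul' le_rfl (mul_le_of_le_one_left' ?_)
  rw [ENNReal.ofReal_le_one, Real.exp_le_one_iff]
  have ht' : 0 < t := ht
  have : 0 ≤ ν * t * ‖ξ‖ ^ (2 * α) := by positivity
  linarith

/-- The difference of two mild solutions. -/
theorem enorm_sub_le_of_mild {φ : 𝓢(R3, ℝ)} (hφ : IsLittlewoodPaley φ) {p : ℝ≥0∞} (hp : 1 ≤ p)
    {ν α Ω : ℝ} (hα : 0 < α) {u₀ v₀ : 𝓢'(R3, C3)} {A₀ B₀ : R3 → C3} (hA : HasFourier u₀ A₀)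
    (hB : HasFourier v₀ B₀) {U V H H' : ℝ → R3 → C3}
    (hU : AEMeasurable (Function.uncurry U) (posTime.prod volume))
    (hV : AEMeasurable (Function.uncurry V) (posTime.prod volume))
    (hH : AEMeasurable (Function.uncurry H) (posTime.prod volume))
    (hH' : AEMeasurable (Function.uncurry H') (posTime.prod volume))
    {t : ℝ} (ht : 0 < t)
    (hUt : ∀ᵐ ξ : R3,
      U t ξ = semigroupHat ν α Ω t u₀ ξ + bilinHat ν α Ω U U t ξ + forceHat ν α Ω H t ξ)
    (hVt : ∀ᵐ ξ : R3,
      V t ξ = semigroupHat ν α Ω t v₀ ξ + bilinHat ν α Ω V V t ξ + forceHat ν α Ω H' t ξ)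
    (hUc : ∀ᵐ τ ∂posTime, ∀ᵐ ξ : R3, conv (fun η => ‖U τ η‖ₑ) (fun η => ‖U τ η‖ₑ) ξ < ∞)
    (hVc : ∀ᵐ τ ∂posTime, ∀ᵐ ξ : R3, conv (fun η => ‖V τ η‖ₑ) (fun η => ‖V τ η‖ₑ) ξ < ∞)
    (hUd : ∀ j, blk φ p j (duhamel ν α (fun τ ξ => ‖ξ‖ₑ *
      conv (fun η => ‖U τ η‖ₑ) (fun η => ‖U τ η‖ₑ) ξ) t) ≠ ∞)
    (hVd : ∀ j, blk φ p j (duhamel ν α (fun τ ξ => ‖ξ‖ₑ *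
      conv (fun η => ‖V τ η‖ₑ) (fun η => ‖V τ η‖ₑ) ξ) t) ≠ ∞)
    (hHd : ∀ j, blk φ p j (duhamel ν α (fun τ ξ => ‖H τ ξ‖ₑ) t) ≠ ∞)
    (hHd' : ∀ j, blk φ p j (duhamel ν α (fun τ ξ => ‖H' τ ξ‖ₑ) t) ≠ ∞) :
    ∀ᵐ ξ : R3, ‖U t ξ - V t ξ‖ₑ ≤ ‖semigroupHat ν α Ω t (u₀ - v₀) ξ‖ₑ +
      (2916 * (duhamel ν α (fun τ ξ => ‖ξ‖ₑ *
          conv (fun η => ‖U τ η‖ₑ) (fun η => ‖U τ η - V τ η‖ₑ) ξ) t ξ +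
        duhamel ν α (fun τ ξ => ‖ξ‖ₑ *
          conv (fun η => ‖U τ η - V τ η‖ₑ) (fun η => ‖V τ η‖ₑ) ξ) t ξ) +
      324 * duhamel ν α (fun τ ξ => ‖H τ ξ - H' τ ξ‖ₑ) t ξ) := by
  have hcm : ∀ {X Y : ℝ → R3 → ℝ≥0∞}, AEMeasurable (Function.uncurry X) (posTime.prod volume) →
      AEMeasurable (Function.uncurry Y) (posTime.prod volume) →
      AEMeasurable (Function.uncurry fun τ ξ => ‖ξ‖ₑ * conv (X τ) (Y τ) ξ)
        (posTime.prod volume) := fun hX hY =>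
    (measurable_enorm.comp measurable_snd).aemeasurable.mul (aemeasurable_conv hX hY)
  have hdiv : ∀ {W : ℝ → R3 → C3}, AEMeasurable (Function.uncurry W) (posTime.prod volume) →
      (∀ j, blk φ p j (duhamel ν α (fun τ ξ => ‖ξ‖ₑ *
        conv (fun η => ‖W τ η‖ₑ) (fun η => ‖W τ η‖ₑ) ξ) t) ≠ ∞) →
      ∀ᵐ ξ : R3, duhamel ν α (fun τ ξ => ‖divTensorHat (W τ) (W τ) ξ‖ₑ) t ξ < ∞ := by
    intro W hW hWd
    filter_upwards [ae_lt_top_of_blk hφ hp (aemeasurable_duhamel hα ν t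
      (hcm (aemeasurable_uncurry_enorm hW) (aemeasurable_uncurry_enorm hW))) hWd] with ξ hξ
    refine lt_of_le_of_lt (lintegral_mono fun τ =>
      mul_le_mul' le_rfl (enorm_divTensorHat_le (W τ) (W τ) ξ)) ?_
    exact (duhamel_const_mul (c := 9) (by simp) _ ξ).trans_lt (ENNReal.mul_lt_top (by simp) hξ)
  have hUm := aemeasurable_divTensorHat hU hU
  have hVm := aemeasurable_divTensorHat hV hV
  have hw : AEMeasurable (Function.uncurry fun τ ξ => ‖U τ ξ - V τ ξ‖ₑ) (posTime.prod volume) :=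
    (hU.sub hV).enorm
  have h1 := enorm_forceHat_sub_le (Ω := Ω) ht.le hUm hVm (hdiv hU hUd) (hdiv hV hVd)
  have h2 := enorm_forceHat_sub_le (Ω := Ω) ht.le hH hH'
    (ae_lt_top_of_blk hφ hp (aemeasurable_duhamel hα ν t (aemeasurable_uncurry_enorm hH)) hHd)
    (ae_lt_top_of_blk hφ hp (aemeasurable_duhamel hα ν t (aemeasurable_uncurry_enorm hH')) hHd')
  have h3 : ∀ᵐ ξ : R3, duhamel ν α (fun τ ξ =>
      ‖divTensorHat (U τ) (U τ) ξ - divTensorHat (V τ) (V τ) ξ‖ₑ) t ξ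
      ≤ duhamel ν α (fun τ ξ => 9 * (‖ξ‖ₑ *
          conv (fun η => ‖U τ η‖ₑ) (fun η => ‖U τ η - V τ η‖ₑ) ξ + ‖ξ‖ₑ *
          conv (fun η => ‖U τ η - V τ η‖ₑ) (fun η => ‖V τ η‖ₑ) ξ)) t ξ := by
    refine duhamel_mono_ae (hUm.sub hVm).enorm
      (((hcm (aemeasurable_uncurry_enorm hU) hw).add
        (hcm hw (aemeasurable_uncurry_enorm hV))).const_mul _) ?_
    filter_upwards [hUc, hVc, ae_aemeasurable_section hU, ae_aemeasurable_section hV]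
      with τ h1 h2 h3 h4
    filter_upwards [h1, h2] with ξ h1 h2
    rw [← mul_add]
    exact enorm_divTensorHat_sub_le h3 h4 h1.ne h2.ne
  filter_upwards [hUt, hVt, h1, h2, h3, duhamel_add_ae (ν := ν) (t := t) hα _
    (hcm (aemeasurable_uncurry_enorm hU) hw), semigroupHat_sub_ae ν α Ω t hA hB]
    with ξ hUt hVt h1 h2 h3 h4 h5
  rw [duhamel_const_mul (by simp)] at h3
  rw [h4] at h3
  have e : U t ξ - V t ξ = (semigroupHat ν α Ω t u₀ ξ - semigroupHat ν α Ω t v₀ ξ) +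
      ((bilinHat ν α Ω U U t ξ - bilinHat ν α Ω V V t ξ) +
        (forceHat ν α Ω H t ξ - forceHat ν α Ω H' t ξ)) := by
    rw [hUt, hVt]; abel
  rw [e, h5]
  refine (enorm_add_le _ _).trans (add_le_add le_rfl ((enorm_add_le _ _).trans
    (add_le_add ?_ h2)))
  have e2 : bilinHat ν α Ω U U t ξ - bilinHat ν α Ω V V t ξ
      = -(forceHat ν α Ω (fun τ ξ => divTensorHat (U τ) (U τ) ξ) t ξ
        - forceHat ν α Ω (fun τ ξ => divTensorHat (V τ) (V τ) ξ) t ξ) := by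
    rw [bilinHat_eq_neg_forceHat, bilinHat_eq_neg_forceHat]; abel
  rw [e2, enorm_neg]
  refine h1.trans ?_
  have h9 : (2916 : ℝ≥0∞) = 324 * 9 := by norm_num
  rw [h9, mul_assoc]
  exact mul_le_mul' le_rfl h3

end FNSC

end


/-! ### Proof of the stability theorem. -/

open FNSC
theorem theorem2 (φ : 𝓢(R3, ℝ)) (hφ : IsLittlewoodPaley φ) (p q : ℝ≥0∞) (hp : 1 < p) (hq : 1 ≤ q)
    (ν α : ℝ) (hν : 0 < ν) (hα : 1 / 2 < α) (hα' : α < (1 / 4) * (5 - (3 / p).toReal)) :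
    ∃ K : ℝ, 0 < K ∧ BilinearBound φ (4 - 2 * α - (3 / p).toReal) p q ν α K ∧
      ∀ ε : ℝ, 0 < ε → ε < 1 / (4 * K) →
      ∀ (Ω : ℝ) (u₀ v₀ : 𝓢'(R3, C3)) (F G u v : ℝ → 𝓢'(R3, C3)),
        MemFB φ (4 - 2 * α - (3 / p).toReal) p q u₀ →
        MemFB φ (4 - 2 * α - (3 / p).toReal) p q v₀ →
        MemPath φ (4 - 4 * α - (3 / p).toReal) p q F →
        MemPath φ (4 - 4 * α - (3 / p).toReal) p q G →
        fbNorm φ (4 - 2 * α - (3 / p).toReal) p q u₀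
          + pathNorm φ (4 - 4 * α - (3 / p).toReal) p q F < ENNReal.ofReal ε →
        fbNorm φ (4 - 2 * α - (3 / p).toReal) p q v₀
          + pathNorm φ (4 - 4 * α - (3 / p).toReal) p q G < ENNReal.ofReal ε →
        MemPath φ (4 - 2 * α - (3 / p).toReal) p q u →
        MemPath φ (4 - 2 * α - (3 / p).toReal) p q v →
        pathNorm φ (4 - 2 * α - (3 / p).toReal) p q u ≤ ENNReal.ofReal (2 * ε) →
        pathNorm φ (4 - 2 * α - (3 / p).toReal) p q v ≤ ENNReal.ofReal (2 * ε) →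
        IsMildSolution ν α Ω u₀ F u →
        IsMildSolution ν α Ω v₀ G v →
        Tendsto (fun t : ℝ => fbNormHat φ (4 - 2 * α - (3 / p).toReal) p q
          (semigroupHat ν α Ω t (u₀ - v₀))) atTop (𝓝 0) →
        Tendsto (fun t : ℝ => fbNorm φ (4 - 4 * α - (3 / p).toReal) p q (F t - G t))
          atTop (𝓝 0) →
        Tendsto (fun t : ℝ => fbNorm φ (4 - 2 * α - (3 / p).toReal) p q (u t - v t))
          atTop (𝓝 0) := by
  have hα0 : 0 < α := by linarith
  have hp1 := hp.le
  set s := 4 - 2 * α - (3 / p).toReal with hs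
  have hsF : 4 - 4 * α - (3 / p).toReal = s - 2 * α := by rw [hs]; ring
  rw [hsF]
  -- The two bounds on $\alpha$: this one is $\alpha>\frac12$, the next is
  -- $\alpha<\frac14(5-\frac3p)$.
  have hs1 : s < 3 - (3 / p).toReal := by linarith
  have hs2 : 0 < 2 * s - (3 - (3 / p).toReal) := by linarith
  obtain ⟨C, hC, hbil⟩ := exists_bilinear_majorant hφ hp1 hq hν hα0 hs1 hs2 hs
  obtain ⟨C₂, hC₂, hduh⟩ := exists_duhamel_majorant hφ (q := q) hp1 hq hν hα0
  obtain ⟨C₃, hC₃, hconv⟩ := exists_conv_majorant hφ (q := q) hp1 hq hs1 hs2 rfl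
  -- $2916=18\cdot18\cdot9$ collects the matrix bounds for the semigroup, the Leray projector and
  -- the divergence; the $1$ makes $K$ positive even if $C=0$.
  set K : ℝ := (2916 * C).toReal + 1 with hK
  have hK0 : 0 < K := by positivity
  have hCK : 2916 * C ≤ ENNReal.ofReal K := by
    rw [← ENNReal.ofReal_toReal (a := 2916 * C) (by finiteness)]
    exact ENNReal.ofReal_le_ofReal (by rw [hK]; linarith)
  refine ⟨K, hK0, ?_, ?_⟩
  · intro Ω v w V W _ _ hV hW
    rw [hV.pathNorm_eq, hW.pathNorm_eq, pathNormHat_eq]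
    -- With $T=0$ there is no past, so $r=0$ is allowed.
    obtain ⟨c, hc, hc'⟩ := hbil _ _ (aemeasurable_uncurry_enorm hV.aemeasurable)
      (aemeasurable_uncurry_enorm hW.aemeasurable) 0 0 le_rfl
    rw [zero_mul, add_zero] at hc
    have hm : ∀ t, AEMeasurable (duhamel ν α (fun τ ξ => ‖ξ‖ₑ *
        conv (fun η => ‖V τ η‖ₑ) (fun η => ‖W τ η‖ₑ) ξ) t) := fun t =>
      aemeasurable_duhamel hα0 ν t ((measurable_enorm.comp measurable_snd).aemeasurable.mul
        (aemeasurable_conv (aemeasurable_uncurry_enorm hV.aemeasurable)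
          (aemeasurable_uncurry_enorm hW.aemeasurable)))
    calc _ ≤ seqNorm s q (fun j => 2916 * c j) := by
          refine seqNorm_mono fun j => tail_le_of_ae ?_
          filter_upwards [ae_restrict_mem measurableSet_Ioi] with t ht
          refine (blk_mono_ae (Eventually.of_forall fun ξ =>
            enorm_bilinHat_le (le_of_lt ht) V W ξ)).trans ?_
          rw [blk_const_mul hp1 (hm t)]
          exact mul_le_mul' le_rfl (hc' t ht (by simp) j)
      _ ≤ 2916 * (C * _) := by
          rw [seqNorm_const_mul hq]
          exact mul_le_mul' le_rfl hc
      _ ≤ _ := by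
          rw [← mul_assoc, mul_assoc (ENNReal.ofReal K)]
          exact mul_le_mul' hCK le_rfl
  intro ε hε hεK Ω u₀ v₀ F G u v hu₀ hv₀ hF hG _ _ hu hv huε hvε hmu hmv hlin hforce
  obtain ⟨A₀, hA⟩ := hu₀.1
  obtain ⟨B₀, hB⟩ := hv₀.1
  obtain ⟨U, H, hU, hH, hUeq⟩ := hmu
  obtain ⟨V, H', hV, hH', hVeq⟩ := hmv
  have hUm := hU.aemeasurable
  have hVm := hV.aemeasurable
  have hHm := hH.aemeasurable
  have hHm' := hH'.aemeasurable
  have hufin := hu.2.2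
  have hvfin := hv.2.2
  have hFfin := hF.2.2
  have hGfin := hG.2.2
  rw [hU.pathNorm_eq] at huε hufin
  rw [hV.pathNorm_eq] at hvε hvfin
  rw [hH.pathNorm_eq] at hFfin
  rw [hH'.pathNorm_eq] at hGfin
  set f : ℝ → R3 → ℝ≥0∞ := fun t ξ => ‖U t ξ‖ₑ with hf
  set g : ℝ → R3 → ℝ≥0∞ := fun t ξ => ‖V t ξ‖ₑ with hg
  set w : ℝ → R3 → ℝ≥0∞ := fun t ξ => ‖U t ξ - V t ξ‖ₑ with hw
  set h : ℝ → R3 → ℝ≥0∞ := fun t ξ => ‖H t ξ - H' t ξ‖ₑ with hh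
  set e : ℝ → R3 → ℝ≥0∞ := fun t ξ => ‖semigroupHat ν α Ω t (u₀ - v₀) ξ‖ₑ with he
  have hfm : AEMeasurable (Function.uncurry f) (posTime.prod volume) := hUm.enorm
  have hgm : AEMeasurable (Function.uncurry g) (posTime.prod volume) := hVm.enorm
  have hwm : AEMeasurable (Function.uncurry w) (posTime.prod volume) := (hUm.sub hVm).enorm
  have hhm : AEMeasurable (Function.uncurry h) (posTime.prod volume) := (hHm.sub hHm').enorm
  have hcm : ∀ {X Y : ℝ → R3 → ℝ≥0∞}, AEMeasurable (Function.uncurry X) (posTime.prod volume) →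
      AEMeasurable (Function.uncurry Y) (posTime.prod volume) → ∀ t, AEMeasurable
        (duhamel ν α (fun τ ξ => ‖ξ‖ₑ * conv (X τ) (Y τ) ξ) t) := fun hX hY t =>
    aemeasurable_duhamel hα0 ν t
      ((measurable_enorm.comp measurable_snd).aemeasurable.mul (aemeasurable_conv hX hY))
  -- finiteness of the quadratic terms
  have hcfin : ∀ {X : ℝ → R3 → ℝ≥0∞}, AEMeasurable (Function.uncurry X) (posTime.prod volume) →
      tailNorm φ s p q 0 X < ∞ → ∀ᵐ τ ∂posTime, ∀ᵐ ξ : R3, conv (X τ) (X τ) ξ < ∞ := by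
    intro X hX hXfin
    obtain ⟨c, hc, hc'⟩ := hconv (tail φ p 0 X) (tail φ p 0 X)
    have hcf : seqNorm _ q c ≠ ∞ := ne_top_of_le_ne_top
      (ENNReal.mul_ne_top (ENNReal.mul_ne_top hC₃ hXfin.ne) hXfin.ne) hc
    filter_upwards [ae_blk_le_tail φ p 0 X, ae_aemeasurable_section hX,
      ae_aemeasurable_section (aemeasurable_conv hX hX)] with τ h1 h2 h3
    exact ae_lt_top_of_blk hφ hp1 h3 fun j =>
      ne_top_of_le_ne_top (ne_top_of_seqNorm_ne_top hq hcf j) (hc' _ _ h2 h2 h1 h1 j)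
  have hdfin : ∀ {X : ℝ → R3 → ℝ≥0∞}, AEMeasurable (Function.uncurry X) (posTime.prod volume) →
      tailNorm φ s p q 0 X < ∞ → ∀ t > 0, ∀ j,
        blk φ p j (duhamel ν α (fun τ ξ => ‖ξ‖ₑ * conv (X τ) (X τ) ξ) t) ≠ ∞ := by
    intro X hX hXfin t ht j
    obtain ⟨c, hc, hc'⟩ := hbil X X hX hX 0 0 le_rfl
    have hcf : seqNorm s q c ≠ ∞ := by
      refine ne_top_of_le_ne_top ?_ hc
      rw [zero_mul, add_zero]
      exact ENNReal.mul_ne_top hC (ENNReal.mul_ne_top hXfin.ne hXfin.ne)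
    exact ne_top_of_le_ne_top (ne_top_of_seqNorm_ne_top hq hcf j) (hc' t ht (by simp) j)
  have hffin : ∀ {X : ℝ → R3 → ℝ≥0∞}, AEMeasurable (Function.uncurry X) (posTime.prod volume) →
      tailNorm φ (s - 2 * α) p q 0 X < ∞ → ∀ t > 0, ∀ j, blk φ p j (duhamel ν α X t) ≠ ∞ := by
    intro X hX hXfin t ht j
    obtain ⟨c, hc, hc'⟩ := hduh s X hX 0 0 le_rfl _ _ (fun _ => le_rfl) (fun _ => le_rfl)
    have hcf : seqNorm s q c ≠ ∞ := by
      refine ne_top_of_le_ne_top ?_ hc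
      rw [zero_mul, add_zero]
      exact ENNReal.mul_ne_top hC₂ hXfin.ne
    exact ne_top_of_le_ne_top (ne_top_of_seqNorm_ne_top hq hcf j) (hc' t ht (by simp) j)
  -- the inequality for the difference, and the size of its right-hand side
  have hdiff : ∀ t > 0, ∀ᵐ ξ : R3, w t ξ ≤ e t ξ +
      (2916 * (duhamel ν α (fun τ ξ => ‖ξ‖ₑ * conv (f τ) (w τ) ξ) t ξ +
        duhamel ν α (fun τ ξ => ‖ξ‖ₑ * conv (w τ) (g τ) ξ) t ξ) +
      324 * duhamel ν α h t ξ) := fun t ht =>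
    enorm_sub_le_of_mild hφ hp1 hα0 hA hB hUm hVm hHm hHm' ht (hUeq t ht) (hVeq t ht)
      (hcfin hfm hufin) (hcfin hgm hvfin) (hdfin hfm hufin t ht) (hdfin hgm hvfin t ht)
      (hffin (aemeasurable_uncurry_enorm hHm) hFfin t ht)
      (hffin (aemeasurable_uncurry_enorm hHm') hGfin t ht)
  set D : ℝ → ℝ≥0∞ := fun T => tailNorm φ s p q T w with hD
  set Y : ℝ → ℝ≥0∞ := fun T => tailNorm φ (s - 2 * α) p q T h with hY
  have hD0 : D 0 ≠ ∞ := by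
    refine ne_top_of_le_ne_top (ENNReal.add_ne_top.2 ⟨hufin.ne, hvfin.ne⟩)
      (le_trans ?_ (tailNorm_add_le hp1 hq le_rfl hfm hgm))
    exact seqNorm_mono fun j => essSup_mono_ae <| Eventually.of_forall fun t =>
      blk_mono_ae (Eventually.of_forall fun ξ => enorm_sub_le)
  have hY0 : Y 0 ≠ ∞ := by
    refine ne_top_of_le_ne_top (ENNReal.add_ne_top.2 ⟨hFfin.ne, hGfin.ne⟩)
      (le_trans ?_ (tailNorm_add_le hp1 hq le_rfl (aemeasurable_uncurry_enorm hHm)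
        (aemeasurable_uncurry_enorm hHm')))
    exact seqNorm_mono fun j => essSup_mono_ae <| Eventually.of_forall fun t =>
      blk_mono_ae (Eventually.of_forall fun ξ => enorm_sub_le)
  -- Each of the two bilinear terms of the difference contains $u$ or $v$, of norm at most
  -- $2\varepsilon$; hence $4\varepsilon$, and $k\le4K\varepsilon<1$.
  set k : ℝ≥0∞ := 2916 * C * ENNReal.ofReal (4 * ε) with hk
  set M : ℝ≥0∞ := 2916 * C * ENNReal.ofReal (4 * ε) * D 0 + 324 * C₂ * Y 0 with hM
  have hMt : M ≠ ∞ := by finiteness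
  have hk1 : k < 1 := by
    refine lt_of_le_of_lt (mul_le_mul' hCK le_rfl) ?_
    rw [← ENNReal.ofReal_mul hK0.le, ENNReal.ofReal_lt_one]
    rw [lt_div_iff₀ (by positivity)] at hεK
    linarith
  have h4ε : ENNReal.ofReal (2 * ε) + ENNReal.ofReal (2 * ε) = ENNReal.ofReal (4 * ε) := by
    rw [← ENNReal.ofReal_add (by positivity) (by positivity)]; congr 1; ring
  -- One majorant serves all times with $T/(t-T)\le r$. It is used twice: for the supremum over
  -- $t>T'$ and at a single time.
  have hmaj : ∀ (T : ℝ) (r : ℝ≥0∞), 0 ≤ T → ∃ X : ℤ → ℝ≥0∞,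
      seqNorm s q X ≤ k * D T + r * M + 324 * C₂ * Y T ∧
      ∀ t > T, ENNReal.ofReal (T / (t - T)) ≤ r → ∀ j,
        blk φ p j (w t) ≤ blk φ p j (e t) + X j := by
    intro T r hT
    obtain ⟨c₁, hc₁, hc₁'⟩ := hbil f w hfm hwm T r hT
    obtain ⟨c₂, hc₂, hc₂'⟩ := hbil w g hwm hgm T r hT
    obtain ⟨c₃, hc₃, hc₃'⟩ := hduh s h hhm T r hT _ _ (fun _ => le_rfl) (fun _ => le_rfl)
    refine ⟨fun j => 2916 * (c₁ j + c₂ j) + 324 * c₃ j, ?_, fun t ht hr j => ?_⟩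
    · have hfT := (tailNorm_anti φ s p q hT f).trans huε
      have hgT := (tailNorm_anti φ s p q hT g).trans hvε
      refine (seqNorm_add_le hq _ _).trans ?_
      rw [seqNorm_const_mul hq, seqNorm_const_mul hq]
      calc _ ≤ 2916 * (C * (ENNReal.ofReal (2 * ε) * D T + r * (ENNReal.ofReal (2 * ε) * D 0)) +
            C * (D T * ENNReal.ofReal (2 * ε) + r * (D 0 * ENNReal.ofReal (2 * ε)))) +
            324 * (C₂ * (Y T + r * Y 0)) := by
            refine add_le_add (mul_le_mul' le_rfl ((seqNorm_add_le hq _ _).trans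
              (add_le_add (hc₁.trans ?_) (hc₂.trans ?_)))) (mul_le_mul' le_rfl hc₃)
            · exact mul_le_mul' le_rfl (add_le_add (mul_le_mul' hfT le_rfl)
                (mul_le_mul' le_rfl (mul_le_mul' huε le_rfl)))
            · exact mul_le_mul' le_rfl (add_le_add (mul_le_mul' le_rfl hgT)
                (mul_le_mul' le_rfl (mul_le_mul' le_rfl hvε)))
        _ = _ := by rw [hk, hM, ← h4ε]; ring
    · have ht0 : 0 < t := hT.trans_lt ht
      have hem : AEMeasurable (e t) := (aemeasurable_semigroupHat ν α Ω t (hA.sub hB)).enorm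
      have hm₁ := hcm hfm hwm t
      have hm₂ := hcm hwm hgm t
      have hm₃ := aemeasurable_duhamel hα0 ν t hhm
      refine (blk_mono_ae (hdiff t ht0)).trans ?_
      refine (blk_add_le hp1 hem (((hm₁.add hm₂).const_mul _).add (hm₃.const_mul _))).trans ?_
      refine add_le_add le_rfl ?_
      refine (blk_add_le hp1 ((hm₁.add hm₂).const_mul _) (hm₃.const_mul _)).trans ?_
      refine add_le_add ?_ ?_
      · refine (blk_const_mul hp1 (hm₁.add hm₂) _).le.trans (mul_le_mul' le_rfl ?_)
        exact (blk_add_le hp1 hm₁ hm₂).trans (add_le_add (hc₁' t ht hr j) (hc₂' t ht hr j))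
      · exact (blk_const_mul hp1 hm₃ _).le.trans (mul_le_mul' le_rfl (hc₃' t ht hr j))
  have hElim : Tendsto (fun T => tailNorm φ s p q T e) atTop (𝓝 0) := by
    refine tendsto_tailNorm_zero hq ?_ (by simpa only [fbNormHat_eq] using hlin)
    refine ne_top_of_le_ne_top ?_ (tailNorm_semigroupHat_le hp1 hq hν α Ω (hA.sub hB))
    refine ENNReal.mul_ne_top (by simp) ?_
    have h1 := hu₀.2
    have h2 := hv₀.2
    rw [hA.fbNorm_eq] at h1
    rw [hB.fbNorm_eq] at h2
    rw [(hA.sub hB).fbNorm_eq]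
    refine ne_top_of_le_ne_top (ENNReal.add_ne_top.2 ⟨h1.ne, h2.ne⟩)
      (le_trans (seqNorm_mono fun j => ?_) (seqNorm_add_le hq _ _))
    exact (blk_mono_ae (Eventually.of_forall fun ξ => enorm_sub_le)).trans
      (blk_add_le hp1 hA.aemeasurable.enorm hB.aemeasurable.enorm)
  have hYlim : Tendsto Y atTop (𝓝 0) := by
    refine tendsto_tailNorm_zero hq hY0 (hforce.congr' ?_)
    filter_upwards [eventually_gt_atTop 0] with t ht
    exact ((hH.2 t ht).sub (hH'.2 t ht)).fbNorm_eq φ _ p q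
  have hc₂t : 324 * C₂ ≠ ∞ := by finiteness
  -- For $t>T'$ one has $T/(t-T)\le T/(T'-T)$, so a single `X` bounds the whole tail after $T'$.
  have hDlim : Tendsto D atTop (𝓝 0) := by
    refine tendsto_zero_of_tail_contraction (fun T T' hTT => tailNorm_anti φ s p q hTT w) hD0 hk1
      hc₂t hMt hElim hYlim fun T hT T' hTT => ?_
    obtain ⟨X, hX, hX'⟩ := hmaj T (ENNReal.ofReal (T / (T' - T))) hT
    refine (le_trans (seqNorm_mono fun j => ?_) (seqNorm_add_le hq (tail φ p T' e) X)).trans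
      (add_le_add le_rfl hX)
    refine tail_le_of_ae ?_
    filter_upwards [ae_blk_le_tail φ p T' e, ae_restrict_mem measurableSet_Ioi] with t h1 ht
    have ht' : T' < t := ht
    have : 0 < T' - T := sub_pos.2 hTT
    refine (hX' t (hTT.trans ht') (ENNReal.ofReal_le_ofReal (by gcongr)) j).trans
      (add_le_add (h1 j) le_rfl)
  -- Decay of `D` controls only almost every time. The mild equation holds at each $t>0$, so the
  -- estimate is applied again at a fixed $t$, with the decay of `D` and `Y` now known.
  have hNlim : Tendsto (fun t => seqNorm s q fun j => blk φ p j (w t)) atTop (𝓝 0) := by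
    refine tendsto_zero_of_le_tail (B := fun T => k * D T + 324 * C₂ * Y T) hMt
      (by simpa only [fbNormHat_eq] using hlin) ?_ fun T hT t ht => ?_
    · have := (ENNReal.Tendsto.const_mul hDlim (Or.inr hk1.ne_top)).add
        (ENNReal.Tendsto.const_mul hYlim (Or.inr hc₂t))
      simpa using this
    · obtain ⟨X, hX, hX'⟩ := hmaj T (ENNReal.ofReal (T / (t - T))) hT
      refine (le_trans (seqNorm_mono fun j => hX' t ht le_rfl j)
        (seqNorm_add_le hq _ X)).trans (add_le_add le_rfl (hX.trans (le_of_eq ?_)))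
      ring
  refine hNlim.congr' ?_
  filter_upwards [eventually_gt_atTop 0] with t ht
  exact (((hU.2 t ht).sub (hV.2 t ht)).fbNorm_eq φ _ p q).symm
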